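/- Let $k\ge 1$ be an integer and $a>0$ a real number. The Buckley--Osthus random graph is defined as follows. $H_{a,1}^{(1)}$ is the graph with one node $1$ and one loop; for $n\ge 2$, $H_{a,1}^{(n)}$ is obtained from $H_{a,1}^{(n-1)}$ by adding a node $n$ and an edge between $n$ and a random node $\gamma\in\{1,\dots,n\}$, where, given $H_{a,1}^{(n-1)}$, $\Pr(\gamma=s)=\frac{\deg(s)-1+a}{(a+1)n-1}$ for $1\le s\le n-1$ (degrees in $H_{a,1}^{(n-1)}$, loops counted twice) and $\Pr(\gamma=n)=\frac{a}{(a+1)n-1}$. The random multigraph $H_{a,k}^{(t)}$ on $t$ nodes is obtained from $H_{a,1}^{(kt)}$ by identifying the nodes $1,\dots,k$; $k+1,\dots,2k$; and so on, keeping all edges. Let $X(d_1,d_2,t)$ be the total number of edges of $H_{a,k}^{(t)}$ linking a node of degree $d_1$ and a node of degree $d_2$; loops are not counted, and when $d_1=d_2$ every other edge is counted twice. Then there is a function $c_X(d_1,d_2)$ on pairs of integers $d_1,d_2\ge k$, depending only on $a$ and $k$, such that $$\mathbb E X(d_1,d_2,t)=c_X(d_1,d_2)\,t+O_{a,k}(1)$$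 uniformly in $d_1,d_2\ge k$ and $t\ge 1$ (this determines $c_X$ uniquely), and the following holds. If $d_1=d_1(t)$ and $d_2=d_2(t)$ are integers with $d_1,d_2\ge k$ for all large $t$ and $$(d_1+d_2)^a d_1^2 d_2^2=o\left(\sqrt t\right)\qquad(t\to\infty),$$ then, with probability tending to $1$, $X(d_1,d_2,t)\sim c_X(d_1,d_2)\,t$; that is, for every $\varepsilon>0$, $$\Pr\Big(\big|X(d_1,d_2,t)-c_X(d_1,d_2)\,t\big|\le\varepsilon\,c_X(d_1,d_2)\,t\Big)\to 1\qquad(t\to\infty).$$ -/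

import Mathlib

open Filter Topology MeasureTheory Asymptotics

namespace BuckleyOsthus

/-- A finite undirected graph with loops and multiple edges on nodes labelled by natural numbers,
given by the multiset of its edges; `s(u, v)` is an edge between `u` and `v`, and `s(v, v)` is a
loop at `v`. -/
structure Multigraph where
  edges : Multiset (Sym2 ℕ)

/-- Every set of multigraphs is an event. -/
instance : MeasurableSpace Multigraph := ⊤

namespace Multigraph

/-- The degree of the node `v`: the number of edges at `v`, loops counted twice. -/
def deg (G : Multigraph) (v : ℕ) : ℕ :=
  G.edges.countP (fun e => v ∈ e) + G.edges.count s(v, v)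

/-- The image of a graph under the identification of the nodes `j * k, …, j * k + k - 1` to one
node `j`, for every `j`; all edges are kept. -/
def collapse (k : ℕ) (G : Multigraph) : Multigraph :=
  ⟨G.edges.map (Sym2.map (fun v => v / k))⟩

/-- `X(d₁, d₂, t)`: the total number of edges linking a node of degree `d₁` with a node of degree
`d₂` in a graph on the nodes `0, …, t - 1`, as a sum over ordered pairs of distinct nodes. Loops
are not counted, and for `d₁ = d₂` every edge is counted twice. -/
def X (d₁ d₂ t : ℕ) (G : Multigraph) : ℕ :=
  ∑ u ∈ Finset.range t, ∑ v ∈ Finset.range t,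
    if u ≠ v ∧ G.deg u = d₁ ∧ G.deg v = d₂ then G.edges.count s(u, v) else 0

end Multigraph

/-- The graphs of the one-edge-per-node process with `n` nodes `0, …, n - 1` and `n` edges: a graph
with `n + 1` nodes arises from one with `n` nodes by adding the node `n` and an edge between `n`
and some `γ ∈ {0, …, n}`. -/
inductive Graph1 : ℕ → Type
  | empty : Graph1 0
  | attach {n : ℕ} (G : Graph1 n) (γ : Fin (n + 1)) : Graph1 (n + 1)

/-- The underlying multigraph. -/
def Graph1.toMultigraph : {n : ℕ} → Graph1 n → Multigraph
  | _, .empty => ⟨0⟩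
  | n + 1, .attach G γ => ⟨s(n, (γ : ℕ)) ::ₘ G.toMultigraph.edges⟩

/-- The probability that the edge of the new node `n` goes to `s ∈ {0, …, n}`, given the graph `G`
on the nodes `0, …, n - 1`. With `t = n + 1` nodes after the step, the denominator is
`(a + 1) t - 1`. -/
noncomputable def targetProb (a : ℝ) {n : ℕ} (G : Graph1 n) (s : Fin (n + 1)) : ℝ :=
  if (s : ℕ) < n then ((G.toMultigraph.deg s : ℝ) - 1 + a) / ((a + 1) * (n + 1 : ℝ) - 1)
  else a / ((a + 1) * (n + 1 : ℝ) - 1)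

theorem deg_attach {n : ℕ} (G : Graph1 n) (γ : Fin (n + 1)) (v : ℕ) :
    (Graph1.attach G γ).toMultigraph.deg v =
      G.toMultigraph.deg v + ((if v = n then 1 else 0) + (if v = γ then 1 else 0)) := by
  simp only [Multigraph.deg, Graph1.toMultigraph, Multiset.countP_cons, Multiset.count_cons,
    Sym2.mem_iff, Sym2.eq_iff]
  split_ifs <;> omega

theorem deg_eq_zero {n : ℕ} (G : Graph1 n) : ∀ v : ℕ, n ≤ v → G.toMultigraph.deg v = 0 := by
  induction G with
  | empty => intro v _; simp [Graph1.toMultigraph, Multigraph.deg]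
  | attach G γ ih =>
    intro v hv
    have hγ := γ.2
    rw [deg_attach, ih v (by omega), if_neg (by omega), if_neg (by omega)]

theorem one_le_deg {n : ℕ} (G : Graph1 n) : ∀ v : ℕ, v < n → 1 ≤ G.toMultigraph.deg v := by
  induction G with
  | empty => intro v hv; omega
  | @attach n G γ ih =>
    intro v hv
    rw [deg_attach]
    by_cases h : v = n
    · simp only [h, if_true]; omega
    · have := ih v (by omega); omega

theorem sum_deg {n : ℕ} (G : Graph1 n) :
    ∑ v ∈ Finset.range n, G.toMultigraph.deg v = 2 * n := by
  induction G with
  | empty => simp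
  | @attach n G γ ih =>
    have hγ : (γ : ℕ) ∈ Finset.range (n + 1) := Finset.mem_range.2 γ.2
    have hn : n ∈ Finset.range (n + 1) := Finset.mem_range.2 (Nat.lt_succ_self n)
    simp only [deg_attach, Finset.sum_add_distrib]
    rw [Finset.sum_ite_eq' _ n, Finset.sum_ite_eq' _ (γ : ℕ), if_pos hγ, if_pos hn,
      Finset.sum_range_succ, ih, deg_eq_zero G n le_rfl]
    omega

theorem denom_pos {a : ℝ} (ha : 0 < a) (n : ℕ) : 0 < (a + 1) * (n + 1 : ℝ) - 1 := by
  have : (0 : ℝ) ≤ n := n.cast_nonneg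
  nlinarith

theorem targetProb_nonneg {a : ℝ} (ha : 0 < a) {n : ℕ} (G : Graph1 n) (s : Fin (n + 1)) :
    0 ≤ targetProb a G s := by
  have hd := denom_pos ha n
  unfold targetProb
  split_ifs with h
  · have : (1 : ℝ) ≤ (G.toMultigraph.deg s : ℝ) := by exact_mod_cast one_le_deg G s h
    exact div_nonneg (by linarith) hd.le
  · positivity

theorem sum_targetProb {a : ℝ} (ha : 0 < a) {n : ℕ} (G : Graph1 n) :
    ∑ s, targetProb a G s = 1 := by
  have hd := denom_pos ha n
  have hs : ∑ s ∈ Finset.range n, (G.toMultigraph.deg s : ℝ) = 2 * n := by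
    exact_mod_cast sum_deg G
  rw [Fin.sum_univ_castSucc]
  simp only [targetProb, Fin.val_castSucc, Fin.is_lt, if_true, Fin.val_last, lt_irrefl, if_false]
  rw [← Finset.sum_div, Fin.sum_univ_eq_sum_range
    (fun i => (G.toMultigraph.deg i : ℝ) - 1 + a) n, Finset.sum_add_distrib,
    Finset.sum_sub_distrib, hs]
  simp only [Finset.sum_const, Finset.card_range, nsmul_eq_mul]
  rw [← add_div, div_eq_one_iff_eq hd.ne']
  ring

/-- The law of the target of the new edge, given the present graph. -/
noncomputable def target {a : ℝ} (ha : 0 < a) {n : ℕ} (G : Graph1 n) : PMF (Fin (n + 1)) :=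
  PMF.ofFintype (fun s => ENNReal.ofReal (targetProb a G s)) (by
    rw [← ENNReal.ofReal_sum_of_nonneg (fun s _ => targetProb_nonneg ha G s),
      sum_targetProb ha G, ENNReal.ofReal_one])

/-- The random graph `H_{a,1}^{(n)}`. For `n = 1` it is one node with a loop. -/
noncomputable def H1 {a : ℝ} (ha : 0 < a) : (n : ℕ) → PMF (Graph1 n)
  | 0 => PMF.pure .empty
  | n + 1 => (H1 ha n).bind fun G => (target ha G).map fun γ => .attach G γ

/-- The random graph `H_{a,k}^{(t)}` on the nodes `0, …, t - 1`: it is obtained from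
`H_{a,1}^{(k t)}` by identifying consecutive groups of `k` nodes. -/
noncomputable def H {a : ℝ} (ha : 0 < a) (k t : ℕ) : PMF Multigraph :=
  (H1 ha (k * t)).map fun G => G.toMultigraph.collapse k

/-- The expectation of `X(d₁, d₂, t)` in `H_{a,k}^{(t)}`. -/
noncomputable def expX {a : ℝ} (ha : 0 < a) (k d₁ d₂ t : ℕ) : ℝ :=
  ∫ G, (Multigraph.X d₁ d₂ t G : ℝ) ∂(H ha k t).toMeasure

end BuckleyOsthus

/-!
The attachment probabilities are affine in the degrees, so a completed group of `k` nodes with total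
degree `d` receives the next edge with probability `(d - k + k a) / Δₙ`, `Δₙ = (a + 1)(n + 1) - 1`
(`sum_targetProb_complete`). Degrees are written `k + i` and the weight is `wt i = i + k a`. The
expected number of completed groups of degree `k + i`, and the expected number of edges between
completed groups of degrees `k + i` and `k + j`, therefore satisfy linear recursions in `n`
(`expDeg_succ`, `expEdges_succ`). Their inhomogeneous parts come from the completion of a group. A
group has a loop with probability `O(1 / n)` only, so up to errors of that order a new group has
degree `k`, and its `k` edges go to groups found with the current degree distribution
(`exists_abs_completion_sub_le`).

*Expectation.* Solutions that are linear in `Δₙ` have as coefficients the densities `rho` and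
`edgeDensity`, and the errors satisfy the same recursions with sources `O(1 / Δₙ)`. For edges, the
coefficients of one step add up to at most `1 - η / Δₙ` for some `η > 0`, so the supremum of the
errors stays bounded (`bounded_of_edge_recursion`). For degrees the error is needed with the weight
`wt i`, with which a step is an exact convex combination; as the sources vanish for all but finitely
many `i`, the weighted errors stay bounded too (`bounded_of_degree_recursion`). The coefficients of
the recursions are negative at degrees of order larger than `n`, which do not occur in the graph and
where the densities are small.

*Variance.* If the target of one edge is changed from `s` to `s'`, the later steps can be coupled so
that all targets agree, except that `s` and `s'` may be exchanged. The two final graphs then agree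
away from two merged nodes, and `X(d₁, d₂)` differs by at most `2 (d₁ + d₂)`. So the increments of
the martingale of conditional expectations of `X` are bounded by `2 (d₁ + d₂)`, and the variance by
`4 k t (d₁ + d₂)²` (`meanM_X_sq_le`).

*Lower bound.* The recursion for `edgeDensity` has the solution
`φ(i + j) / (wt i (wt i + 1) wt j (wt j + 1))` at `i, j ≥ 1`, where `φ` is a quotient of Gamma
functions with `φ(m)` of order `m ^ (1 - a)`, and a small multiple of it is a subsolution up to the
boundary. Hence the density at `(d₁, d₂) ≠ (k, k)` is at least of the order of
`(d₁ + d₂) ^ (1 - a) / (d₁² d₂²)` (`exists_rpow_le_edgeDensity`), and the hypothesis on `d₁, d₂` says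
that `c_X t` is large compared with `(d₁ + d₂) √t`. Chebyshev's inequality finishes the proof. For
`(d₁, d₂) = (k, k)` both the density and `X` vanish.
-/

namespace BuckleyOsthus

/-! ### Expectations over the one-edge process -/

/-- A graph with `n + 1` nodes is a graph with `n` nodes together with the target of its last
edge. -/
def Graph1.succEquiv (n : ℕ) : Graph1 n × Fin (n + 1) ≃ Graph1 (n + 1) where
  toFun p := .attach p.1 p.2
  invFun | .attach G γ => (G, γ)
  left_inv _ := rfl
  right_inv | .attach _ _ => rfl

noncomputable instance Graph1.instFintype : (n : ℕ) → Fintype (Graph1 n)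
  | 0 => ⟨{.empty}, fun G => by cases G; simp⟩
  | n + 1 =>
    haveI := Graph1.instFintype n
    Fintype.ofEquiv _ (Graph1.succEquiv n)

/-- The probability that the process produces the graph `G`. -/
noncomputable def prob (a : ℝ) : {n : ℕ} → Graph1 n → ℝ
  | _, .empty => 1
  | _, .attach G γ => prob a G * targetProb a G γ

/-- The expectation of `f` over the random graph `H_{a,1}^{(n)}`. -/
noncomputable def mean (a : ℝ) {n : ℕ} (f : Graph1 n → ℝ) : ℝ := ∑ G, prob a G * f G

variable {a : ℝ}

theorem prob_nonneg (ha : 0 < a) {n : ℕ} (G : Graph1 n) : 0 ≤ prob a G := by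
  induction G with
  | empty => simp [prob]
  | attach G γ ih => exact mul_nonneg ih (targetProb_nonneg ha G γ)

theorem mean_zero (f : Graph1 0 → ℝ) : mean a f = f .empty := by
  rw [mean, Fintype.sum_eq_single Graph1.empty (fun G hG => by cases G; simp at hG)]
  simp [prob]

/-- Conditioning on the graph before the last step. -/
theorem mean_succ {n : ℕ} (f : Graph1 (n + 1) → ℝ) :
    mean a f = mean a fun G => ∑ γ, targetProb a G γ * f (.attach G γ) := by
  unfold mean
  rw [← (Graph1.succEquiv n).sum_comp, Fintype.sum_prod_type]
  refine Finset.sum_congr rfl fun G _ => ?_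
  rw [Finset.mul_sum]
  refine Finset.sum_congr rfl fun γ _ => ?_
  exact mul_assoc _ _ _

theorem mean_add {n : ℕ} (f g : Graph1 n → ℝ) :
    mean a (fun G => f G + g G) = mean a f + mean a g := by
  simp [mean, mul_add, Finset.sum_add_distrib]

theorem mean_sub {n : ℕ} (f g : Graph1 n → ℝ) :
    mean a (fun G => f G - g G) = mean a f - mean a g := by
  simp [mean, mul_sub, Finset.sum_sub_distrib]

theorem mean_const_mul {n : ℕ} (c : ℝ) (f : Graph1 n → ℝ) :
    mean a (fun G => c * f G) = c * mean a f := by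
  simp only [mean, Finset.mul_sum]
  exact Finset.sum_congr rfl fun _ _ => by ring

theorem mean_mono (ha : 0 < a) {n : ℕ} {f g : Graph1 n → ℝ} (h : ∀ G, f G ≤ g G) :
    mean a f ≤ mean a g :=
  Finset.sum_le_sum fun G _ => mul_le_mul_of_nonneg_left (h G) (prob_nonneg ha G)

theorem mean_one (ha : 0 < a) : ∀ n : ℕ, mean a (fun _ : Graph1 n => (1 : ℝ)) = 1
  | 0 => mean_zero _
  | n + 1 => by
    rw [mean_succ]
    simpa [sum_targetProb ha] using mean_one ha n

theorem mean_const (ha : 0 < a) {n : ℕ} (c : ℝ) : mean a (fun _ : Graph1 n => c) = c := by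
  have := mean_const_mul (a := a) (n := n) c fun _ => 1
  simpa [mean_one ha] using this

theorem mean_nonneg (ha : 0 < a) {n : ℕ} {f : Graph1 n → ℝ} (h : ∀ G, 0 ≤ f G) : 0 ≤ mean a f :=
  Finset.sum_nonneg fun G _ => mul_nonneg (prob_nonneg ha G) (h G)

/-- Expectation of a function of the multigraph that arises from `H_{a,1}^{(n)}` by merging groups
of `k` nodes; `n` need not be a multiple of `k`. The number `n` is an explicit argument, free of the
indexed type `Graph1 n`, so that it can be rewritten. -/
noncomputable def meanM (a : ℝ) (k n : ℕ) (F : Multigraph → ℝ) : ℝ :=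
  mean a fun G : Graph1 n => F (G.toMultigraph.collapse k)

theorem H1_apply (ha : 0 < a) {n : ℕ} (G : Graph1 n) :
    H1 ha n G = ENNReal.ofReal (prob a G) := by
  induction G with
  | empty => simp [H1, prob]
  | @attach n G γ ih =>
    rw [prob, ENNReal.ofReal_mul (prob_nonneg ha G), ← ih, H1, PMF.bind_apply, tsum_fintype]
    rw [Finset.sum_eq_single G]
    · rw [PMF.map_apply, tsum_fintype, Finset.sum_eq_single γ]
      · simp [target]
      · intro γ' _ h
        rw [if_neg]
        simpa using fun h' => h h'.symm
      · simp
    · intro G' _ h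
      rw [PMF.map_apply, ENNReal.tsum_eq_zero.2, mul_zero]
      intro γ'
      rw [if_neg]
      intro h'
      simp only [Graph1.attach.injEq] at h'
      exact h h'.1.symm
    · simp

theorem integral_H (ha : 0 < a) (k t : ℕ) (F : Multigraph → ℝ) :
    ∫ G, F G ∂(H ha k t).toMeasure = meanM a k (k * t) F := by
  let _ : MeasurableSpace (Graph1 (k * t)) := ⊤
  have : MeasurableSingletonClass (Graph1 (k * t)) := ⟨fun _ => trivial⟩
  have hm : Measurable fun G : Graph1 (k * t) => G.toMultigraph.collapse k := fun _ _ => trivial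
  have hF : Measurable F := fun _ _ => trivial
  rw [H, ← PMF.toMeasure_map (hf := hm), integral_map hm.aemeasurable hF.aestronglyMeasurable,
    PMF.integral_eq_sum]
  refine Finset.sum_congr rfl fun G _ => ?_
  rw [H1_apply, ENNReal.toReal_ofReal (prob_nonneg ha G), smul_eq_mul]

theorem measure_H (ha : 0 < a) (k t : ℕ) (p : Multigraph → Prop) [DecidablePred p] :
    (H ha k t).toMeasure {G | p G} =
      ENNReal.ofReal (meanM a k (k * t) fun G => if p G then 1 else 0) := by
  have hs : MeasurableSet {G | p G} := trivial
  rw [← integral_H ha k t fun G => if p G then 1 else 0]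
  have : (fun G => if p G then (1 : ℝ) else 0) = Set.indicator {G | p G} 1 := by
    ext G; simp [Set.indicator]
  rw [this, integral_indicator_one hs, measureReal_def,
    ENNReal.ofReal_toReal (measure_ne_top _ _)]

/-! ### Merged graphs -/

theorem Multigraph.sum_count_le_deg (G : Multigraph) (S : Finset ℕ) (u : ℕ) :
    ∑ v ∈ S, (if u ≠ v then G.edges.count s(u, v) else 0) ≤ G.deg u := by
  obtain ⟨E⟩ := G
  simp only [Multigraph.deg]
  refine le_trans ?_ (Nat.le_add_right _ _)
  induction E using Multiset.induction_on with
  | empty => simp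
  | cons e E ih =>
    simp only [Multiset.count_cons, Multiset.countP_cons]
    have : ∑ v ∈ S, (if u ≠ v then E.count s(u, v) + (if s(u, v) = e then 1 else 0) else 0) =
        ∑ v ∈ S, (if u ≠ v then E.count s(u, v) else 0) +
          ∑ v ∈ S, (if u ≠ v ∧ s(u, v) = e then 1 else 0) := by
      rw [← Finset.sum_add_distrib]
      refine Finset.sum_congr rfl fun v _ => ?_
      split_ifs <;> simp_all
    rw [this]
    refine add_le_add ih ?_
    rw [← Finset.card_filter]
    split_ifs with h
    · obtain ⟨y, rfl⟩ := h
      refine Finset.card_le_one.2 fun v hv v' hv' => ?_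
      simp only [Finset.mem_filter, Sym2.congr_right] at hv hv'
      rw [hv.2.2, hv'.2.2]
    · rw [Nat.le_zero, Finset.card_eq_zero, Finset.filter_eq_empty_iff]
      rintro v _ ⟨_, rfl⟩
      exact h (Sym2.mem_mk_left _ _)

variable {k n : ℕ}

theorem count_collapse_attach (G : Graph1 n) (γ : Fin (n + 1)) (e : Sym2 ℕ) :
    ((Graph1.attach G γ).toMultigraph.collapse k).edges.count e =
      (G.toMultigraph.collapse k).edges.count e + if e = s(n / k, γ / k) then 1 else 0 := by
  simp [Multigraph.collapse, Graph1.toMultigraph, Multiset.count_cons]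

theorem deg_collapse_attach (G : Graph1 n) (γ : Fin (n + 1)) (v : ℕ) :
    ((Graph1.attach G γ).toMultigraph.collapse k).deg v =
      (G.toMultigraph.collapse k).deg v +
        ((if v = n / k then 1 else 0) + (if v = γ / k then 1 else 0)) := by
  simp only [Multigraph.deg, Multigraph.collapse, Graph1.toMultigraph, Multiset.map_cons,
    Sym2.map_mk, Multiset.countP_cons, Multiset.count_cons, Sym2.mem_iff, Sym2.eq_iff]
  split_ifs <;> omega

theorem deg_collapse_empty (v : ℕ) : (Graph1.empty.toMultigraph.collapse k).deg v = 0 := by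
  simp [Multigraph.deg, Multigraph.collapse, Graph1.toMultigraph]

theorem deg_collapse_eq_sum (G : Graph1 n) (u : ℕ) :
    (G.toMultigraph.collapse k).deg u =
      ∑ v ∈ Finset.range n, if v / k = u then G.toMultigraph.deg v else 0 := by
  induction G with
  | empty => simp [deg_collapse_empty]
  | @attach n G γ ih =>
    have h : ∀ v, (if v / k = u then (Graph1.attach G γ).toMultigraph.deg v else 0) =
        (if v / k = u then G.toMultigraph.deg v else 0) +
          ((if v = n then (if n / k = u then 1 else 0) else 0) +
            (if v = γ then (if (γ : ℕ) / k = u then 1 else 0) else 0)) := by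
      intro v
      rw [deg_attach]
      by_cases h1 : v = n <;> by_cases h2 : v = γ <;> by_cases h3 : v / k = u <;>
        simp_all
    have hγ : (γ : ℕ) ∈ Finset.range (n + 1) := Finset.mem_range.2 γ.2
    have hn : n ∈ Finset.range (n + 1) := Finset.mem_range.2 (Nat.lt_succ_self n)
    simp only [h, Finset.sum_add_distrib]
    rw [Finset.sum_ite_eq' _ n, Finset.sum_ite_eq' _ (γ : ℕ), if_pos hγ, if_pos hn,
      Finset.sum_range_succ, deg_eq_zero G n le_rfl, deg_collapse_attach, ih]
    simp [eq_comm]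

/-- The number of nodes `v < n` in the group `u`. -/
def groupSize (k n u : ℕ) : ℕ := ∑ v ∈ Finset.range n, if v / k = u then 1 else 0

theorem groupSize_current (c : ℕ) {r : ℕ} (hr : r ≤ k) : groupSize k (c * k + r) c = r := by
  induction r with
  | zero =>
    refine Finset.sum_eq_zero fun v hv => if_neg ?_
    exact (Nat.div_lt_of_lt_mul (by simpa [mul_comm] using hv)).ne
  | succ r ih =>
    have : (c * k + r) / k = c := by
      rw [mul_comm, Nat.mul_add_div (by omega), Nat.div_eq_of_lt (by omega), add_zero]
    have ih' := ih (by omega)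
    unfold groupSize at ih' ⊢
    rw [← add_assoc, Finset.sum_range_succ, ih', if_pos this]

theorem groupSize_complete (hk : 1 ≤ k) {u : ℕ} (hu : (u + 1) * k ≤ n) : groupSize k n u = k := by
  obtain ⟨m, rfl⟩ := Nat.exists_eq_add_of_le hu
  have h0 := groupSize_current (k := k) u le_rfl
  unfold groupSize at h0 ⊢
  rw [Finset.sum_range_add, show (u + 1) * k = u * k + k by ring, h0, Finset.sum_eq_zero, add_zero]
  intro v _
  refine if_neg ?_
  have : u + 1 ≤ (u * k + k + v) / k :=
    (Nat.le_div_iff_mul_le (by omega)).2 (by rw [add_mul]; omega)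
  omega

theorem le_deg_complete (hk : 1 ≤ k) (G : Graph1 n) {u : ℕ} (hu : (u + 1) * k ≤ n) :
    k ≤ (G.toMultigraph.collapse k).deg u := by
  rw [deg_collapse_eq_sum]
  refine (groupSize_complete hk hu).ge.trans (Finset.sum_le_sum fun v hv => ?_)
  split_ifs
  · exact one_le_deg G v (Finset.mem_range.1 hv)
  · exact le_rfl

theorem deg_complete_le (hk : 1 ≤ k) (G : Graph1 n) {u : ℕ} (hu : (u + 1) * k ≤ n) :
    (G.toMultigraph.collapse k).deg u ≤ n + k := by
  have h : ∑ v ∈ Finset.range n, ((if v / k = u then G.toMultigraph.deg v else 0) + 1) ≤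
      ∑ v ∈ Finset.range n, (G.toMultigraph.deg v + if v / k = u then 1 else 0) := by
    refine Finset.sum_le_sum fun v hv => ?_
    have := one_le_deg G v (Finset.mem_range.1 hv)
    split_ifs <;> omega
  have h2 := groupSize_complete hk hu
  rw [Finset.sum_add_distrib, Finset.sum_add_distrib, sum_deg, ← deg_collapse_eq_sum] at h
  unfold groupSize at h2
  simp only [h2, Finset.sum_const, Finset.card_range, smul_eq_mul] at h
  omega

theorem deg_add_deg_complete_le (hk : 1 ≤ k) (G : Graph1 n) {u u' : ℕ} (hu : (u + 1) * k ≤ n)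
    (hu' : (u' + 1) * k ≤ n) (huu' : u ≠ u') :
    (G.toMultigraph.collapse k).deg u + (G.toMultigraph.collapse k).deg u' ≤ n + 2 * k := by
  have h : ∑ v ∈ Finset.range n, ((if v / k = u then G.toMultigraph.deg v else 0) +
        (if v / k = u' then G.toMultigraph.deg v else 0) + 1) ≤
      ∑ v ∈ Finset.range n, (G.toMultigraph.deg v + (if v / k = u then 1 else 0) +
        if v / k = u' then 1 else 0) := by
    refine Finset.sum_le_sum fun v hv => ?_
    have := one_le_deg G v (Finset.mem_range.1 hv)
    split_ifs <;> omega
  have h2 := groupSize_complete hk hu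
  have h3 := groupSize_complete hk hu'
  simp only [Finset.sum_add_distrib] at h
  rw [sum_deg, ← deg_collapse_eq_sum, ← deg_collapse_eq_sum] at h
  unfold groupSize at h2 h3
  simp only [h2, h3, Finset.sum_const, Finset.card_range, smul_eq_mul] at h
  omega

/-- The normalization of the attachment probabilities in the step from `n` to `n + 1` nodes. -/
noncomputable def den (a : ℝ) (n : ℕ) : ℝ := (a + 1) * (n + 1 : ℝ) - 1

theorem den_pos (ha : 0 < a) (n : ℕ) : 0 < den a n := denom_pos ha n

/-- The new edge goes to a group with a probability that depends on the merged degree only. -/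
theorem sum_targetProb_group (G : Graph1 n) (u : ℕ) :
    ∑ γ, targetProb a G γ * (if (γ : ℕ) / k = u then 1 else 0) =
      ((G.toMultigraph.collapse k).deg u + (a - 1) * groupSize k n u +
        if n / k = u then a else 0) / den a n := by
  rw [Fin.sum_univ_castSucc]
  simp only [targetProb, Fin.val_castSucc, Fin.is_lt, if_true, Fin.val_last, lt_irrefl, if_false]
  rw [Fin.sum_univ_eq_sum_range (fun i => ((G.toMultigraph.deg i : ℝ) - 1 + a) /
    ((a + 1) * (n + 1 : ℝ) - 1) * (if i / k = u then 1 else 0)) n, deg_collapse_eq_sum, groupSize]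
  push_cast
  rw [Finset.mul_sum, ← Finset.sum_add_distrib, den, add_div, Finset.sum_div]
  congr 1
  · refine Finset.sum_congr rfl fun v _ => ?_
    split_ifs <;> ring
  · split_ifs <;> ring

theorem sum_targetProb_complete (hk : 1 ≤ k) (G : Graph1 n) {u : ℕ} (hu : (u + 1) * k ≤ n) :
    ∑ γ, targetProb a G γ * (if (γ : ℕ) / k = u then 1 else 0) =
      ((G.toMultigraph.collapse k).deg u - k + k * a) / den a n := by
  have : u + 1 ≤ n / k := (Nat.le_div_iff_mul_le (by omega)).2 hu
  rw [sum_targetProb_group, groupSize_complete hk hu, if_neg (by omega)]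
  ring

theorem deg_current (c : ℕ) : ∀ r : ℕ, r ≤ k → ∀ G : Graph1 (c * k + r),
    r ≤ (G.toMultigraph.collapse k).deg c ∧ (G.toMultigraph.collapse k).deg c ≤ 2 * r
  | 0, _, G => by
    rw [deg_collapse_eq_sum, Finset.sum_eq_zero]
    · simp
    · intro v hv
      exact if_neg (Nat.div_lt_of_lt_mul (by simpa [mul_comm] using hv)).ne
  | r + 1, hr, .attach G γ => by
    have h := deg_current c r (by omega) G
    have : (c * k + r) / k = c := by
      rw [mul_comm, Nat.mul_add_div (by omega), Nat.div_eq_of_lt (by omega), add_zero]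
    rw [deg_collapse_attach, show (c * k).add r / k = c from this]
    split_ifs <;> omega

theorem sum_targetProb_current_le (ha : 0 < a) (c : ℕ) {r : ℕ} (hr : r < k)
    (G : Graph1 (c * k + r)) :
    ∑ γ, targetProb a G γ * (if (γ : ℕ) / k = c then 1 else 0) ≤
      (k + k * a) / den a (c * k + r) := by
  have : (c * k + r) / k = c := by
    rw [mul_comm, Nat.mul_add_div (by omega), Nat.div_eq_of_lt (by omega), add_zero]
  rw [sum_targetProb_group, groupSize_current c hr.le, if_pos this]
  refine div_le_div_of_nonneg_right ?_ (den_pos ha _).le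
  have h : ((G.toMultigraph.collapse k).deg c : ℝ) ≤ 2 * r := by
    exact_mod_cast (deg_current c r hr.le G).2
  have h' : (r : ℝ) + 1 ≤ k := by exact_mod_cast hr
  nlinarith

/-! ### Degree counts and their one-step recursions -/

/-- The shift of a sequence by one index, with value `0` at index `0`. -/
def prev (g : ℕ → ℝ) : ℕ → ℝ
  | 0 => 0
  | i + 1 => g i

/-- `wt a k i` is the weight of a complete group of degree `k + i`: its probability to receive the
new edge is `wt a k i / den a n`. -/
noncomputable def wt (a : ℝ) (k i : ℕ) : ℝ := i + k * a

/-- The indicator of `D = k + i`; throughout, degrees are measured by their excess over `k`. -/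
def ind (k D i : ℕ) : ℝ := if D = k + i then 1 else 0

/-- The number of nodes of degree `k + i` among the first `c` nodes. -/
def numDeg (k c i : ℕ) (M : Multigraph) : ℝ := ∑ u ∈ Finset.range c, ind k (M.deg u) i

/-- The number of edges between the node `c` and those of the first `c` nodes that have degree
`k + i`. -/
def numNew (k c i : ℕ) (M : Multigraph) : ℝ :=
  ∑ u ∈ Finset.range c, ind k (M.deg u) i * M.edges.count s(u, c)

/-- `X(k + i, k + j, c)` as a real-valued sum. -/
def numEdges (k c i j : ℕ) (M : Multigraph) : ℝ :=
  ∑ u ∈ Finset.range c, ∑ v ∈ Finset.range c,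
    ind k (M.deg u) i * ind k (M.deg v) j * if u ≠ v then (M.edges.count s(u, v) : ℝ) else 0

theorem X_eq_numEdges (k c i j : ℕ) (M : Multigraph) :
    (M.X (k + i) (k + j) c : ℝ) = numEdges k c i j M := by
  simp only [Multigraph.X, numEdges, ind]
  push_cast
  refine Finset.sum_congr rfl fun u _ => Finset.sum_congr rfl fun v _ => ?_
  split_ifs <;> simp_all

theorem ind_nonneg (k D i : ℕ) : 0 ≤ ind k D i := by unfold ind; split_ifs <;> norm_num

theorem ind_le_one (k D i : ℕ) : ind k D i ≤ 1 := by unfold ind; split_ifs <;> norm_num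

theorem numDeg_nonneg (k c i : ℕ) (M : Multigraph) : 0 ≤ numDeg k c i M :=
  Finset.sum_nonneg fun _ _ => ind_nonneg _ _ _

theorem numNew_nonneg (k c i : ℕ) (M : Multigraph) : 0 ≤ numNew k c i M :=
  Finset.sum_nonneg fun _ _ => mul_nonneg (ind_nonneg _ _ _) (Nat.cast_nonneg _)

theorem numEdges_nonneg (k c i j : ℕ) (M : Multigraph) : 0 ≤ numEdges k c i j M := by
  rw [← X_eq_numEdges]
  exact Nat.cast_nonneg _

theorem numDeg_succ (k c i : ℕ) (M : Multigraph) :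
    numDeg k (c + 1) i M = numDeg k c i M + ind k (M.deg c) i := by
  rw [numDeg, Finset.sum_range_succ, numDeg]

theorem numEdges_succ (k c i j : ℕ) (M : Multigraph) :
    numEdges k (c + 1) i j M = numEdges k c i j M +
      (ind k (M.deg c) i * numNew k c j M + ind k (M.deg c) j * numNew k c i M) := by
  have h1 : ∀ u ∈ Finset.range c, ∑ v ∈ Finset.range (c + 1), ind k (M.deg u) i *
      ind k (M.deg v) j * (if u ≠ v then (M.edges.count s(u, v) : ℝ) else 0) =
      ∑ v ∈ Finset.range c, ind k (M.deg u) i *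
        ind k (M.deg v) j * (if u ≠ v then (M.edges.count s(u, v) : ℝ) else 0) +
        ind k (M.deg c) j * (ind k (M.deg u) i * M.edges.count s(u, c)) := by
    intro u hu
    rw [Finset.sum_range_succ, if_pos (Finset.mem_range.1 hu).ne]
    ring
  have h2 : ∀ v ∈ Finset.range c, ind k (M.deg c) i *
      ind k (M.deg v) j * (if c ≠ v then (M.edges.count s(c, v) : ℝ) else 0) =
      ind k (M.deg c) i * (ind k (M.deg v) j * M.edges.count s(v, c)) := by
    intro v hv
    rw [if_pos (Finset.mem_range.1 hv).ne', Sym2.eq_swap]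
    ring
  rw [numEdges, Finset.sum_range_succ, Finset.sum_congr rfl h1, Finset.sum_add_distrib,
    Finset.sum_range_succ, Finset.sum_congr rfl h2, ← Finset.mul_sum, ← Finset.mul_sum]
  simp only [numEdges, numNew, ne_eq, not_true_eq_false, if_false, mul_zero, add_zero]
  ring


theorem wt_pos (ha : 0 < a) (hk : 1 ≤ k) (i : ℕ) : 0 < wt a k i := by
  have : (1 : ℝ) ≤ k := by exact_mod_cast hk
  unfold wt
  positivity

theorem wt_succ (a : ℝ) (k i : ℕ) : wt a k (i + 1) = wt a k i + 1 := by
  simp only [wt]; push_cast; ring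

theorem prev_sum {ι : Type*} (s : Finset ι) (g : ι → ℕ → ℝ) (i : ℕ) :
    prev (fun i => ∑ u ∈ s, g u i) i = ∑ u ∈ s, prev (g u) i := by
  cases i <;> simp [prev]

theorem prev_mul_const (g : ℕ → ℝ) (c : ℝ) (i : ℕ) : prev (fun i => g i * c) i = prev g i * c := by
  cases i <;> simp [prev]

theorem weight_mul_ind (D i : ℕ) : ((D : ℝ) - k + k * a) * ind k D i = wt a k i * ind k D i := by
  unfold ind wt
  split_ifs with h
  · subst h; push_cast; ring
  · simp

theorem weight_mul_ind_succ {D : ℕ} (hD : k ≤ D) (i : ℕ) :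
    ((D : ℝ) - k + k * a) * ind k (D + 1) i = prev (fun i => wt a k i * ind k D i) i := by
  cases i with
  | zero => simp only [ind, prev]; rw [if_neg (by omega), mul_zero]
  | succ i =>
    have : ind k (D + 1) (i + 1) = ind k D i := by
      unfold ind
      exact if_congr (by omega) rfl rfl
    rw [this, weight_mul_ind, prev]

/-- The conditional expectation, given `G`, of a function of the merged graph one step later. -/
noncomputable def condStep (a : ℝ) (k : ℕ) (G : Graph1 n) (F : Multigraph → ℝ) : ℝ :=
  ∑ γ, targetProb a G γ * F ((Graph1.attach G γ).toMultigraph.collapse k)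

theorem meanM_succ (F : Multigraph → ℝ) :
    meanM a k (n + 1) F = mean a fun G : Graph1 n => condStep a k G F := mean_succ _

theorem sum_targetProb_affine (ha : 0 < a) (hk : 1 ≤ k) (G : Graph1 n) {u : ℕ}
    (hu : (u + 1) * k ≤ n) (b d : ℝ) :
    ∑ γ, targetProb a G γ * (b + (if (γ : ℕ) / k = u then 1 else 0) * d) =
      b + ((G.toMultigraph.collapse k).deg u - k + k * a) * d / den a n := by
  simp only [mul_add, ← mul_assoc]
  rw [Finset.sum_add_distrib, ← Finset.sum_mul, ← Finset.sum_mul, sum_targetProb ha,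
    sum_targetProb_complete hk G hu]
  ring

theorem succ_mul_le {c u : ℕ} (hc : c * k ≤ n) (hu : u ∈ Finset.range c) : (u + 1) * k ≤ n :=
  (Nat.mul_le_mul_right k (Finset.mem_range.1 hu)).trans hc

theorem deg_collapse_attach_complete (hk : 1 ≤ k) (G : Graph1 n) (γ : Fin (n + 1)) {u : ℕ}
    (hu : (u + 1) * k ≤ n) :
    ((Graph1.attach G γ).toMultigraph.collapse k).deg u =
      (G.toMultigraph.collapse k).deg u + if (γ : ℕ) / k = u then 1 else 0 := by
  have : u + 1 ≤ n / k := (Nat.le_div_iff_mul_le (by omega)).2 hu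
  rw [deg_collapse_attach, if_neg (by omega), zero_add]
  simp [eq_comm]

theorem ind_attach (hk : 1 ≤ k) (G : Graph1 n) (γ : Fin (n + 1)) {u : ℕ}
    (hu : (u + 1) * k ≤ n) (i : ℕ) :
    ind k (((Graph1.attach G γ).toMultigraph.collapse k).deg u) i =
      ind k ((G.toMultigraph.collapse k).deg u) i + (if (γ : ℕ) / k = u then 1 else 0) *
        (ind k ((G.toMultigraph.collapse k).deg u + 1) i -
          ind k ((G.toMultigraph.collapse k).deg u) i) := by
  rw [deg_collapse_attach_complete hk G γ hu]
  split_ifs <;> simp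

theorem condStep_numDeg (ha : 0 < a) (hk : 1 ≤ k) {c : ℕ} (hc : c * k ≤ n) (G : Graph1 n)
    (i : ℕ) :
    condStep a k G (numDeg k c i) =
      (1 - wt a k i / den a n) * numDeg k c i (G.toMultigraph.collapse k) +
        prev (fun i => wt a k i * numDeg k c i (G.toMultigraph.collapse k)) i / den a n := by
  simp only [condStep, numDeg, Finset.mul_sum]
  rw [Finset.sum_comm, prev_sum, Finset.sum_div, ← Finset.sum_add_distrib]
  refine Finset.sum_congr rfl fun u hu => ?_
  have hu' := succ_mul_le hc hu
  simp only [ind_attach hk G _ hu']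
  rw [sum_targetProb_affine ha hk G hu', mul_sub, weight_mul_ind_succ (le_deg_complete hk G hu'),
    weight_mul_ind]
  ring

theorem condStep_numNew (ha : 0 < a) (hk : 1 ≤ k) {c : ℕ} (hc : n / k = c) (G : Graph1 n)
    (i : ℕ) :
    condStep a k G (numNew k c i) =
      (1 - wt a k i / den a n) * numNew k c i (G.toMultigraph.collapse k) +
        prev (fun i => wt a k i * numNew k c i (G.toMultigraph.collapse k)) i / den a n +
        prev (fun i => wt a k i * numDeg k c i (G.toMultigraph.collapse k)) i / den a n := by
  simp only [condStep, numNew, numDeg, Finset.mul_sum]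
  rw [Finset.sum_comm, prev_sum, prev_sum, Finset.sum_div, Finset.sum_div,
    ← Finset.sum_add_distrib, ← Finset.sum_add_distrib]
  refine Finset.sum_congr rfl fun u hu => ?_
  have hu' := succ_mul_le (hc ▸ Nat.div_mul_le_self n k) hu
  have huc := (Finset.mem_range.1 hu).ne
  set M := G.toMultigraph.collapse k with hM
  have h : ∀ γ : Fin (n + 1), ind k (((Graph1.attach G γ).toMultigraph.collapse k).deg u) i *
      (((Graph1.attach G γ).toMultigraph.collapse k).edges.count s(u, c) : ℝ) =
      ind k (M.deg u) i * M.edges.count s(u, c) + (if (γ : ℕ) / k = u then 1 else 0) *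
        (ind k (M.deg u + 1) i * (M.edges.count s(u, c) + 1) -
          ind k (M.deg u) i * M.edges.count s(u, c)) := by
    intro γ
    rw [count_collapse_attach, deg_collapse_attach_complete hk G γ hu', hc]
    by_cases h : (γ : ℕ) / k = u
    · have : s(u, c) = s(c, (γ : ℕ) / k) := by rw [h, Sym2.eq_swap]
      rw [if_pos this]
      simp [h, hM]
    · have : s(u, c) ≠ s(c, (γ : ℕ) / k) := by
        simp only [ne_eq, Sym2.eq_iff]
        omega
      rw [if_neg this]
      simp [h, hM]
  simp only [h]
  rw [sum_targetProb_affine ha hk G hu', ← hM, mul_sub, ← mul_assoc, ← mul_assoc,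
    weight_mul_ind_succ (le_deg_complete hk G hu'), weight_mul_ind, ← hM]
  simp only [← mul_assoc]
  rw [prev_mul_const]
  ring

theorem condStep_numEdges (ha : 0 < a) (hk : 1 ≤ k) {c : ℕ} (hc : c * k ≤ n) (G : Graph1 n)
    (i j : ℕ) :
    condStep a k G (numEdges k c i j) =
      (1 - (wt a k i + wt a k j) / den a n) * numEdges k c i j (G.toMultigraph.collapse k) +
        prev (fun i => wt a k i * numEdges k c i j (G.toMultigraph.collapse k)) i / den a n +
        prev (fun j => wt a k j * numEdges k c i j (G.toMultigraph.collapse k)) j / den a n := by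
  simp only [condStep, numEdges, Finset.mul_sum]
  rw [Finset.sum_comm, prev_sum, prev_sum, Finset.sum_div, Finset.sum_div,
    ← Finset.sum_add_distrib, ← Finset.sum_add_distrib]
  refine Finset.sum_congr rfl fun u hu => ?_
  rw [Finset.sum_comm, prev_sum, prev_sum, Finset.sum_div, Finset.sum_div,
    ← Finset.sum_add_distrib, ← Finset.sum_add_distrib]
  refine Finset.sum_congr rfl fun v hv => ?_
  by_cases huv : u = v
  · have h0 : prev (fun _ => 0) i = 0 := by cases i <;> rfl
    have h1 : prev (fun _ => 0) j = 0 := by cases j <;> rfl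
    simp [huv, h0, h1]
  have hu' := succ_mul_le hc hu
  have hv' := succ_mul_le hc hv
  set M := G.toMultigraph.collapse k with hM
  simp only [ne_eq, huv, not_false_eq_true, if_true]
  set m : ℝ := (M.edges.count s(u, v) : ℝ) with hm
  have h : ∀ γ : Fin (n + 1), ind k (((Graph1.attach G γ).toMultigraph.collapse k).deg u) i *
      ind k (((Graph1.attach G γ).toMultigraph.collapse k).deg v) j *
      (((Graph1.attach G γ).toMultigraph.collapse k).edges.count s(u, v) : ℝ) =
      (ind k (M.deg u) i * ind k (M.deg v) j * m + (if (γ : ℕ) / k = u then 1 else 0) *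
        ((ind k (M.deg u + 1) i - ind k (M.deg u) i) * (ind k (M.deg v) j * m))) +
      (0 + (if (γ : ℕ) / k = v then 1 else 0) *
        ((ind k (M.deg v + 1) j - ind k (M.deg v) j) * (ind k (M.deg u) i * m))) := by
    intro γ
    have h1 : u + 1 ≤ n / k := (Nat.le_div_iff_mul_le (by omega)).2 hu'
    have h2 : v + 1 ≤ n / k := (Nat.le_div_iff_mul_le (by omega)).2 hv'
    have : s(u, v) ≠ s(n / k, (γ : ℕ) / k) := by
      simp only [ne_eq, Sym2.eq_iff]
      omega
    rw [count_collapse_attach, if_neg this, ind_attach hk G γ hu', ind_attach hk G γ hv', add_zero,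
      ← hM, ← hm]
    by_cases h : (γ : ℕ) / k = u
    · have : ¬ (γ : ℕ) / k = v := fun h' => huv (h.symm.trans h')
      simp only [h, huv, if_true, if_false]
      ring
    · simp only [h, if_false]
      ring
  simp only [h]
  rw [Finset.sum_congr rfl fun γ _ => mul_add _ _ _, Finset.sum_add_distrib,
    sum_targetProb_affine ha hk G hu', sum_targetProb_affine ha hk G hv', ← hM]
  have hD : ∀ {w : ℕ}, (w + 1) * k ≤ n → ∀ (i : ℕ) (x : ℝ), ((M.deg w : ℝ) - k + k * a) *
      ((ind k (M.deg w + 1) i - ind k (M.deg w) i) * x) =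
      (prev (fun i => wt a k i * ind k (M.deg w) i) i - wt a k i * ind k (M.deg w) i) * x := by
    intro w hw i x
    rw [← weight_mul_ind_succ (le_deg_complete hk G hw), ← weight_mul_ind]
    ring
  rw [hD hu', hD hv']
  have e1 : prev (fun i => wt a k i * (ind k (M.deg u) i * ind k (M.deg v) j * m)) i =
      prev (fun i => wt a k i * ind k (M.deg u) i) i * (ind k (M.deg v) j * m) := by
    rw [← prev_mul_const]
    congr 1; ext; ring
  have e2 : prev (fun j => wt a k j * (ind k (M.deg u) i * ind k (M.deg v) j * m)) j =
      prev (fun j => wt a k j * ind k (M.deg v) j) j * (ind k (M.deg u) i * m) := by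
    rw [← prev_mul_const]
    congr 1; ext; ring
  rw [e1, e2]
  ring

theorem meanM_add (F F' : Multigraph → ℝ) :
    meanM a k n (fun M => F M + F' M) = meanM a k n F + meanM a k n F' := mean_add _ _

theorem meanM_const_mul (c : ℝ) (F : Multigraph → ℝ) :
    meanM a k n (fun M => c * F M) = c * meanM a k n F := mean_const_mul _ _

theorem meanM_const (ha : 0 < a) (c : ℝ) : meanM a k n (fun _ => c) = c := mean_const ha c

theorem meanM_nonneg (ha : 0 < a) {F : Multigraph → ℝ} (h : ∀ M, 0 ≤ F M) : 0 ≤ meanM a k n F :=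
  mean_nonneg ha fun _ => h _

theorem meanM_mono (ha : 0 < a) {F F' : Multigraph → ℝ} (h : ∀ M, F M ≤ F' M) :
    meanM a k n F ≤ meanM a k n F' := mean_mono ha fun _ => h _

theorem mean_prev (F : ℕ → Multigraph → ℝ) (g : ℕ → ℝ) (i : ℕ) :
    mean a (fun G : Graph1 n => prev (fun i => g i * F i (G.toMultigraph.collapse k)) i) =
      prev (fun i => g i * meanM a k n (F i)) i := by
  cases i with
  | zero => simp [prev, mean]
  | succ i => exact mean_const_mul _ _

theorem mean_div_const (f : Graph1 n → ℝ) (c : ℝ) : mean a (fun G => f G / c) = mean a f / c := by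
  simp only [mean, Finset.sum_div, mul_div_assoc]

theorem meanM_numDeg_succ (ha : 0 < a) (hk : 1 ≤ k) {c : ℕ} (hc : c * k ≤ n) (i : ℕ) :
    meanM a k (n + 1) (numDeg k c i) =
      (1 - wt a k i / den a n) * meanM a k n (numDeg k c i) +
        prev (fun i => wt a k i * meanM a k n (numDeg k c i)) i / den a n := by
  simp only [meanM_succ, condStep_numDeg ha hk hc]
  rw [mean_add, mean_const_mul, mean_div_const, mean_prev]
  rfl

theorem meanM_numNew_succ (ha : 0 < a) (hk : 1 ≤ k) {c : ℕ} (hc : n / k = c) (i : ℕ) :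
    meanM a k (n + 1) (numNew k c i) =
      (1 - wt a k i / den a n) * meanM a k n (numNew k c i) +
        prev (fun i => wt a k i * meanM a k n (numNew k c i)) i / den a n +
        prev (fun i => wt a k i * meanM a k n (numDeg k c i)) i / den a n := by
  simp only [meanM_succ, condStep_numNew ha hk hc]
  rw [mean_add, mean_add, mean_const_mul, mean_div_const, mean_prev, mean_div_const, mean_prev]
  rfl

theorem meanM_numEdges_succ (ha : 0 < a) (hk : 1 ≤ k) {c : ℕ} (hc : c * k ≤ n) (i j : ℕ) :
    meanM a k (n + 1) (numEdges k c i j) =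
      (1 - (wt a k i + wt a k j) / den a n) * meanM a k n (numEdges k c i j) +
        prev (fun i => wt a k i * meanM a k n (numEdges k c i j)) i / den a n +
        prev (fun j => wt a k j * meanM a k n (numEdges k c i j)) j / den a n := by
  simp only [meanM_succ, condStep_numEdges ha hk hc]
  rw [mean_add, mean_add, mean_const_mul, mean_div_const, mean_div_const,
    mean_prev (F := fun i => numEdges k c i j), mean_prev (F := fun j => numEdges k c i j)]
  rfl

/-! ### A priori bounds and the completion of a group -/

theorem abs_meanM_sub_le (ha : 0 < a) {F F' F'' : Multigraph → ℝ}
    (h : ∀ G : Graph1 n, |F (G.toMultigraph.collapse k) - F' (G.toMultigraph.collapse k)| ≤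
      F'' (G.toMultigraph.collapse k)) :
    |meanM a k n F - meanM a k n F'| ≤ meanM a k n F'' := by
  rw [abs_sub_le_iff]
  unfold meanM
  rw [← mean_sub, ← mean_sub]
  exact ⟨mean_mono ha fun G => (le_abs_self _).trans (h G),
    mean_mono ha fun G => (neg_sub (F _) (F' _) ▸ neg_le_abs _).trans (h G)⟩

theorem meanM_eq_zero {F : Multigraph → ℝ}
    (h : ∀ G : Graph1 n, F (G.toMultigraph.collapse k) = 0) : meanM a k n F = 0 := by
  simp [meanM, mean, h]

theorem meanM_numDeg_eq_zero (hk : 1 ≤ k) {c i : ℕ} (hc : c * k ≤ n) (hi : n < i) :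
    meanM a k n (numDeg k c i) = 0 := by
  refine meanM_eq_zero fun G => Finset.sum_eq_zero fun u hu => if_neg ?_
  have := deg_complete_le hk G (succ_mul_le hc hu)
  omega

theorem meanM_numNew_eq_zero (hk : 1 ≤ k) {c i : ℕ} (hc : c * k ≤ n) (hi : n < i) :
    meanM a k n (numNew k c i) = 0 := by
  refine meanM_eq_zero fun G => Finset.sum_eq_zero fun u hu => ?_
  have := deg_complete_le hk G (succ_mul_le hc hu)
  rw [ind, if_neg (by omega), zero_mul]

theorem meanM_numEdges_eq_zero (hk : 1 ≤ k) {c i j : ℕ} (hc : c * k ≤ n) (hij : n < i + j) :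
    meanM a k n (numEdges k c i j) = 0 := by
  refine meanM_eq_zero fun G => Finset.sum_eq_zero fun u hu => Finset.sum_eq_zero fun v hv => ?_
  by_cases huv : u = v
  · simp [huv]
  · have := deg_add_deg_complete_le hk G (succ_mul_le hc hu) (succ_mul_le hc hv) huv
    unfold ind
    split_ifs <;> first | omega | simp

theorem numDeg_le (k c i : ℕ) (M : Multigraph) : numDeg k c i M ≤ c := by
  refine (Finset.sum_le_sum fun u _ => ind_le_one k (M.deg u) i).trans ?_
  simp

theorem meanM_numDeg_le (ha : 0 < a) (c i : ℕ) : meanM a k n (numDeg k c i) ≤ c :=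
  (meanM_mono ha (numDeg_le k c i)).trans (mean_const ha _).le

theorem exists_meanM_numEdges_le (ha : 0 < a) (n c : ℕ) :
    ∃ C, ∀ i j, meanM a k n (numEdges k c i j) ≤ C := by
  refine ⟨meanM a k n fun M => ∑ u ∈ Finset.range c, ∑ v ∈ Finset.range c,
    (M.edges.count s(u, v) : ℝ), fun i j => meanM_mono ha fun M =>
    Finset.sum_le_sum fun u _ => Finset.sum_le_sum fun v _ => ?_⟩
  have h0 : (0 : ℝ) ≤ (M.edges.count s(u, v) : ℝ) := Nat.cast_nonneg _
  have h1 : ind k (M.deg u) i * ind k (M.deg v) j ≤ 1 :=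
    mul_le_one₀ (ind_le_one _ _ _) (ind_nonneg _ _ _) (ind_le_one _ _ _)
  have h2 := mul_nonneg (ind_nonneg k (M.deg u) i) (ind_nonneg k (M.deg v) j)
  split_ifs
  · nlinarith
  · nlinarith

theorem numNew_le (c : ℕ) {r : ℕ} (hr : r ≤ k) (i : ℕ) (G : Graph1 (c * k + r)) :
    numNew k c i (G.toMultigraph.collapse k) ≤ 2 * r := by
  set M := G.toMultigraph.collapse k with hM
  have h1 := M.sum_count_le_deg (Finset.range c) c
  have h2 := (deg_current c r hr G).2
  have h3 : ∑ v ∈ Finset.range c, (if c ≠ v then M.edges.count s(c, v) else 0) ≤ 2 * r := by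
    rw [← hM] at h2
    omega
  have h4 : ((∑ v ∈ Finset.range c, (if c ≠ v then M.edges.count s(c, v) else 0) : ℕ) : ℝ) ≤
      2 * r := by exact_mod_cast h3
  refine le_trans ?_ h4
  push_cast
  refine Finset.sum_le_sum fun u hu => ?_
  rw [if_pos (Finset.mem_range.1 hu).ne', Sym2.eq_swap (a := c)]
  have := ind_le_one k (M.deg u) i
  have h0 : (0 : ℝ) ≤ (M.edges.count s(u, c) : ℝ) := Nat.cast_nonneg _
  nlinarith

/-- The indicator that the node `c` does not have degree `r`. For the current group after `r` steps
this means that there is a loop. -/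
def degNe (c r : ℕ) (M : Multigraph) : ℝ := if M.deg c = r then 0 else 1

theorem den_mono (ha : 0 < a) {m n : ℕ} (h : m ≤ n) : den a m ≤ den a n := by
  have : (m : ℝ) ≤ n := by exact_mod_cast h
  unfold den
  nlinarith

/-- A group rarely has loops. -/
theorem meanM_degNe_le (ha : 0 < a) (c : ℕ) : ∀ r : ℕ, r ≤ k →
    meanM a k (c * k + r) (degNe c r) ≤ r * ((k + k * a) / den a (c * k))
  | 0, _ => by
    rw [meanM_eq_zero, Nat.cast_zero, zero_mul]
    intro G
    have := (deg_current c 0 (Nat.zero_le k) G).2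
    rw [degNe, if_pos (by omega)]
  | r + 1, hr => by
    have ih := meanM_degNe_le ha c r (by omega)
    have hdiv : (c * k + r) / k = c := by
      rw [mul_comm, Nat.mul_add_div (by omega), Nat.div_eq_of_lt (by omega), add_zero]
    have hstep : ∀ G : Graph1 (c * k + r), condStep a k G (degNe c (r + 1)) ≤
        degNe c r (G.toMultigraph.collapse k) + (k + k * a) / den a (c * k) := by
      intro G
      have h1 : condStep a k G (degNe c (r + 1)) ≤ ∑ γ, targetProb a G γ *
          (degNe c r (G.toMultigraph.collapse k) + if (γ : ℕ) / k = c then 1 else 0) := by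
        refine Finset.sum_le_sum fun γ _ => mul_le_mul_of_nonneg_left ?_ (targetProb_nonneg ha G γ)
        unfold degNe
        rw [deg_collapse_attach, hdiv]
        split_ifs <;> first | omega | norm_num
      refine h1.trans ?_
      simp only [mul_add]
      rw [Finset.sum_add_distrib, ← Finset.sum_mul, sum_targetProb ha, one_mul]
      refine add_le_add le_rfl ((sum_targetProb_current_le ha c (by omega) G).trans ?_)
      have := den_pos ha (c * k)
      exact div_le_div_of_nonneg_left (by positivity) this (den_mono ha (Nat.le_add_right _ _))
    calc meanM a k (c * k + r + 1) (degNe c (r + 1))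
        = mean a fun G : Graph1 (c * k + r) => condStep a k G (degNe c (r + 1)) := meanM_succ _
      _ ≤ mean a fun G : Graph1 (c * k + r) =>
          degNe c r (G.toMultigraph.collapse k) + (k + k * a) / den a (c * k) := mean_mono ha hstep
      _ = meanM a k (c * k + r) (degNe c r) + (k + k * a) / den a (c * k) := by
          rw [mean_add, mean_const ha]; rfl
      _ ≤ _ := by push_cast; linarith

/-- The indicator of index `0`: a new group has degree `k` up to rare loops. -/
def atZero (i : ℕ) : ℝ := if i = 0 then 1 else 0

theorem abs_ind_sub_le (D i : ℕ) : |ind k D i - atZero i| ≤ if D = k then 0 else 1 := by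
  unfold ind atZero
  split_ifs <;> first | omega | norm_num

theorem abs_meanM_ind_sub_le (ha : 0 < a) (c i : ℕ) :
    |meanM a k (c * k + k) (fun M => ind k (M.deg c) i) - atZero i| ≤
      k * ((k + k * a) / den a (c * k)) := by
  refine le_trans ?_ (meanM_degNe_le ha c k le_rfl)
  have := abs_meanM_sub_le (a := a) (k := k) (n := c * k + k) ha
    (F := fun M => ind k (M.deg c) i) (F' := fun _ => atZero i) (F'' := degNe c k)
    fun G => abs_ind_sub_le _ i
  rwa [meanM_const ha] at this

theorem meanM_ind_eq_zero (c : ℕ) {i : ℕ} (hi : k < i) :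
    meanM a k (c * k + k) (fun M => ind k (M.deg c) i) = 0 := by
  refine meanM_eq_zero fun G => if_neg ?_
  have := (deg_current c k le_rfl G).2
  omega

theorem abs_meanM_ind_mul_sub_le (ha : 0 < a) (c i j : ℕ) :
    |meanM a k (c * k + k) (fun M => ind k (M.deg c) i * numNew k c j M) -
      atZero i * meanM a k (c * k + k) (numNew k c j)| ≤
      2 * k * (k * ((k + k * a) / den a (c * k))) := by
  refine le_trans ?_ (mul_le_mul_of_nonneg_left (meanM_degNe_le ha c k le_rfl) (by positivity))
  rw [← meanM_const_mul, ← meanM_const_mul]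
  refine abs_meanM_sub_le ha fun G => ?_
  rw [← sub_mul, abs_mul, abs_of_nonneg (numNew_nonneg _ _ _ _), mul_comm]
  exact mul_le_mul (numNew_le c le_rfl j G) (abs_ind_sub_le _ i) (abs_nonneg _) (by positivity)

/-- The expected number of nodes of degree `k + i` among the groups completed after `n` steps. -/
noncomputable def expDeg (a : ℝ) (k n i : ℕ) : ℝ := meanM a k n (numDeg k (n / k) i)

/-- The expectation of `X(k + i, k + j)` restricted to the groups completed after `n` steps. -/
noncomputable def expEdges (a : ℝ) (k n i j : ℕ) : ℝ := meanM a k n (numEdges k (n / k) i j)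

theorem expDeg_succ (ha : 0 < a) (hk : 1 ≤ k) (n i : ℕ) :
    expDeg a k (n + 1) i =
      (1 - wt a k i / den a n) * expDeg a k n i +
        prev (fun i => wt a k i * expDeg a k n i) i / den a n +
        if k ∣ n + 1 then meanM a k (n + 1) (fun M => ind k (M.deg (n / k)) i) else 0 := by
  have h := meanM_numDeg_succ ha hk (Nat.div_mul_le_self n k) i
  unfold expDeg
  rw [← h, Nat.succ_div]
  split_ifs
  · rw [← meanM_add]
    congr 1
    ext M
    exact numDeg_succ _ _ _ _
  · simp

theorem expEdges_succ (ha : 0 < a) (hk : 1 ≤ k) (n i j : ℕ) :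
    expEdges a k (n + 1) i j =
      (1 - (wt a k i + wt a k j) / den a n) * expEdges a k n i j +
        prev (fun i => wt a k i * expEdges a k n i j) i / den a n +
        prev (fun j => wt a k j * expEdges a k n i j) j / den a n +
        if k ∣ n + 1 then
          meanM a k (n + 1) (fun M => ind k (M.deg (n / k)) i * numNew k (n / k) j M) +
          meanM a k (n + 1) (fun M => ind k (M.deg (n / k)) j * numNew k (n / k) i M)
        else 0 := by
  have h := meanM_numEdges_succ ha hk (Nat.div_mul_le_self n k) i j
  unfold expEdges
  rw [← h, Nat.succ_div]
  split_ifs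
  · rw [← meanM_add, ← meanM_add]
    congr 1
    ext M
    exact numEdges_succ _ _ _ _ _
  · simp

/-! ### The limit densities -/

/-- The limit number of nodes of degree `k + i` per edge of the graph. -/
noncomputable def rho (a : ℝ) (k : ℕ) : ℕ → ℝ
  | 0 => (a + 1) / (k * (wt a k 0 + a + 1))
  | i + 1 => wt a k i * rho a k i / (wt a k (i + 1) + a + 1)

/-- The flow of nodes from degree `k + j - 1` to `k + j`, up to normalization. -/
noncomputable def flow (a : ℝ) (k : ℕ) : ℕ → ℝ := prev fun i => wt a k i * rho a k i

/-- The rate at which new groups contribute edges between degrees `k + i` and `k + j`. -/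
noncomputable def source (a : ℝ) (k i j : ℕ) : ℝ :=
  (atZero i * flow a k j + atZero j * flow a k i) / (a + 1)

/-- The limit of `X(k + i, k + j)` per edge of the graph. -/
noncomputable def edgeDensity (a : ℝ) (k : ℕ) : ℕ → ℕ → ℝ
  | 0, 0 => 0
  | 0, j + 1 => (wt a k j * edgeDensity a k 0 j + wt a k j * rho a k j) /
      (wt a k 0 + wt a k (j + 1) + a + 1)
  | i + 1, 0 => (wt a k i * edgeDensity a k i 0 + wt a k i * rho a k i) /
      (wt a k (i + 1) + wt a k 0 + a + 1)
  | i + 1, j + 1 => (wt a k i * edgeDensity a k i (j + 1) + wt a k j * edgeDensity a k (i + 1) j) /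
      (wt a k (i + 1) + wt a k (j + 1) + a + 1)
termination_by i j => i + j

theorem rho_pos (ha : 0 < a) (hk : 1 ≤ k) : ∀ i, 0 < rho a k i
  | 0 => by
    have := wt_pos ha hk 0
    have : (1 : ℝ) ≤ k := by exact_mod_cast hk
    rw [rho]
    positivity
  | i + 1 => by
    have := wt_pos ha hk i
    have := wt_pos ha hk (i + 1)
    have := rho_pos ha hk i
    rw [rho]
    positivity

theorem rho_eq (ha : 0 < a) (hk : 1 ≤ k) (i : ℕ) :
    rho a k i * (wt a k i + a + 1) = flow a k i + atZero i * (a + 1) / k := by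
  have h := wt_pos ha hk i
  cases i with
  | zero =>
    have : (1 : ℝ) ≤ k := by exact_mod_cast hk
    simp only [rho, flow, prev, atZero, if_true]
    field_simp
    ring
  | succ i =>
    simp only [rho, flow, prev, atZero, Nat.succ_ne_zero, if_false]
    field_simp
    ring

theorem edgeDensity_eq (ha : 0 < a) (hk : 1 ≤ k) (i j : ℕ) :
    edgeDensity a k i j * (wt a k i + wt a k j + a + 1) =
      prev (fun i => wt a k i * edgeDensity a k i j) i +
        prev (fun j => wt a k j * edgeDensity a k i j) j + (a + 1) * source a k i j := by
  have h1 := wt_pos ha hk i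
  have h2 := wt_pos ha hk j
  have h3 : (a + 1) * source a k i j = atZero i * flow a k j + atZero j * flow a k i := by
    unfold source
    field_simp
  rw [h3]
  cases i <;> cases j <;> rw [edgeDensity] <;> simp [prev, flow, atZero] <;> field_simp

theorem edgeDensity_nonneg (ha : 0 < a) (hk : 1 ≤ k) : ∀ i j, 0 ≤ edgeDensity a k i j
  | 0, 0 => by rw [edgeDensity]
  | 0, j + 1 => by
    have := wt_pos ha hk 0; have := wt_pos ha hk j; have := wt_pos ha hk (j + 1)
    have := rho_pos ha hk j; have := edgeDensity_nonneg ha hk 0 j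
    rw [edgeDensity]; positivity
  | i + 1, 0 => by
    have := wt_pos ha hk 0; have := wt_pos ha hk i; have := wt_pos ha hk (i + 1)
    have := rho_pos ha hk i; have := edgeDensity_nonneg ha hk i 0
    rw [edgeDensity]; positivity
  | i + 1, j + 1 => by
    have := wt_pos ha hk i; have := wt_pos ha hk (i + 1)
    have := wt_pos ha hk j; have := wt_pos ha hk (j + 1)
    have := edgeDensity_nonneg ha hk i (j + 1); have := edgeDensity_nonneg ha hk (i + 1) j
    rw [edgeDensity]; positivity
termination_by i j => i + j

/-- `rho` decays like `i ^ (-2 - a)`; decay of order `i ^ (-2)` is enough for upper bounds. -/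
theorem exists_rho_le (ha : 0 < a) (hk : 1 ≤ k) :
    ∃ K, 0 < K ∧ ∀ i, wt a k i * (wt a k i + 1) * rho a k i ≤ K := by
  have h0 := wt_pos ha hk 0
  have hr := rho_pos ha hk 0
  refine ⟨wt a k 0 * (wt a k 0 + 1) * rho a k 0, by positivity, fun i => ?_⟩
  induction i with
  | zero => exact le_rfl
  | succ i ih =>
    refine le_trans ?_ ih
    have h := wt_pos ha hk i
    have hr := rho_pos ha hk i
    rw [rho, wt_succ, ← mul_div_assoc, div_le_iff₀ (by positivity)]
    have : 0 ≤ wt a k i * (wt a k i + 1) * rho a k i * a := by positivity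
    nlinarith

theorem flow_nonneg (ha : 0 < a) (hk : 1 ≤ k) (i : ℕ) : 0 ≤ flow a k i := by
  cases i with
  | zero => exact le_rfl
  | succ i => exact (mul_pos (wt_pos ha hk i) (rho_pos ha hk i)).le

theorem exists_flow_le (ha : 0 < a) (hk : 1 ≤ k) :
    ∃ K, 0 < K ∧ ∀ i, (wt a k i + 1) * flow a k i ≤ K := by
  obtain ⟨K, hK, h⟩ := exists_rho_le ha hk
  refine ⟨2 * K / (wt a k 0) + K, by have := wt_pos ha hk 0; positivity, fun i => ?_⟩
  have h0 := wt_pos ha hk 0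
  cases i with
  | zero => simp only [flow, prev, mul_zero]; positivity
  | succ i =>
    have h1 := wt_pos ha hk i
    have h2 := rho_pos ha hk i
    have h3 := h i
    have h5 : wt a k 0 * (wt a k i * rho a k i) ≤ K := by
      refine le_trans ?_ h3
      have h4 : wt a k 0 ≤ wt a k i := by simp [wt]
      nlinarith [mul_pos h1 h2, mul_pos (mul_pos h1 h1) h2]
    have h6 : wt a k i * rho a k i ≤ K / wt a k 0 := by
      rw [le_div_iff₀ h0]; linarith
    simp only [flow, prev]
    rw [wt_succ]
    have : 2 * K / wt a k 0 = K / wt a k 0 + K / wt a k 0 := by ring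
    have : 0 < K / wt a k 0 := by positivity
    nlinarith

theorem exists_source_le (ha : 0 < a) (hk : 1 ≤ k) :
    ∃ K, 0 < K ∧ ∀ i j, (wt a k i + wt a k j + 1) * |source a k i j| ≤ K := by
  obtain ⟨K, hK, h⟩ := exists_flow_le ha hk
  have h0 := wt_pos ha hk 0
  refine ⟨2 * (K + wt a k 0 * K), by positivity, fun i j => ?_⟩
  have key : ∀ i j, (wt a k i + wt a k j + 1) * (atZero i * flow a k j) ≤ K + wt a k 0 * K := by
    intro i j
    have hj := h j
    have hf := flow_nonneg ha hk j
    have hw := wt_pos ha hk j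
    have hfK : flow a k j ≤ K := by nlinarith
    cases i with
    | zero => simp only [atZero, if_true, one_mul]; nlinarith
    | succ i => simp only [atZero, Nat.succ_ne_zero, if_false, zero_mul, mul_zero]; positivity
  have hz : ∀ i, 0 ≤ atZero i := fun i => by unfold atZero; split_ifs <;> norm_num
  have h1 := mul_nonneg (hz i) (flow_nonneg ha hk j)
  have h2 := mul_nonneg (hz j) (flow_nonneg ha hk i)
  have h3 := key i j
  have h4 := key j i
  have h5 := wt_pos ha hk i
  have h6 := wt_pos ha hk j
  have hs : |source a k i j| ≤ atZero i * flow a k j + atZero j * flow a k i := by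
    unfold source
    rw [abs_of_nonneg (by positivity)]
    exact div_le_self (by positivity) (by linarith)
  calc (wt a k i + wt a k j + 1) * |source a k i j|
      ≤ (wt a k i + wt a k j + 1) * (atZero i * flow a k j + atZero j * flow a k i) :=
        mul_le_mul_of_nonneg_left hs (by positivity)
    _ ≤ _ := by nlinarith

theorem exists_edgeDensity_le (ha : 0 < a) (hk : 1 ≤ k) :
    ∃ K, 0 < K ∧ ∀ i j, edgeDensity a k i j * (wt a k i + wt a k j + 1) ≤ K := by
  obtain ⟨K, hK, h⟩ := exists_source_le ha hk
  have h0 := wt_pos ha hk 0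
  refine ⟨(a + 1) * K, by positivity, ?_⟩
  -- A bound `C / (s + 1)` with `s = wt i + wt j` is reproduced by the recursion with a gain of
  -- order `C / s`, which absorbs the source.
  suffices H : ∀ m i j, i + j = m →
      edgeDensity a k i j * (wt a k i + wt a k j + 1) ≤ (a + 1) * K from fun i j => H _ i j rfl
  intro m
  induction m with
  | zero =>
    intro i j hij
    obtain rfl : i = 0 := by omega
    obtain rfl : j = 0 := by omega
    rw [edgeDensity, zero_mul]
    positivity
  | succ m ih =>
    intro i j hij
    have hi := wt_pos ha hk i
    have hj := wt_pos ha hk j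
    set s := wt a k i + wt a k j with hs
    have hs0 : 0 < s := by positivity
    have p1 : prev (fun i => wt a k i * edgeDensity a k i j) i * s ≤
        (wt a k i - if i = 0 then wt a k 0 else 1) * ((a + 1) * K) := by
      cases i with
      | zero => simp [prev]
      | succ i =>
        have h1 := ih i j (by omega)
        have h2 := wt_pos ha hk i
        rw [wt_succ] at hs
        simp only [prev, Nat.succ_ne_zero, if_false]
        rw [wt_succ, mul_assoc, add_sub_cancel_right]
        refine mul_le_mul_of_nonneg_left ?_ h2.le
        rwa [show s = wt a k i + wt a k j + 1 by rw [hs]; ring]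
    have p2 : prev (fun j => wt a k j * edgeDensity a k i j) j * s ≤
        (wt a k j - if j = 0 then wt a k 0 else 1) * ((a + 1) * K) := by
      cases j with
      | zero => simp [prev]
      | succ j =>
        have h1 := ih i j (by omega)
        have h2 := wt_pos ha hk j
        rw [wt_succ] at hs
        simp only [prev, Nat.succ_ne_zero, if_false]
        rw [wt_succ, mul_assoc, add_sub_cancel_right]
        refine mul_le_mul_of_nonneg_left ?_ h2.le
        rwa [show s = wt a k i + wt a k j + 1 by rw [hs]; ring]
    have p3 : (a + 1) * source a k i j * s ≤ (a + 1) * K := by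
      have h1 := h i j
      have h2 := le_abs_self (source a k i j)
      rw [mul_assoc]
      refine mul_le_mul_of_nonneg_left ?_ (by positivity)
      rw [← hs] at h1
      nlinarith [abs_nonneg (source a k i j)]
    have p4 : (if i = 0 then wt a k 0 else 1) + (if j = 0 then wt a k 0 else 1) ≥ (1 : ℝ) := by
      split_ifs <;> first | omega | linarith
    have heq := edgeDensity_eq ha hk i j
    rw [← hs] at heq
    have htot : edgeDensity a k i j * (s + a + 1) * s ≤ s * ((a + 1) * K) := by
      rw [heq]
      have : (0 : ℝ) < (a + 1) * K := by positivity
      nlinarith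
    have hle : edgeDensity a k i j * (s + a + 1) ≤ (a + 1) * K := by
      nlinarith
    have := edgeDensity_nonneg ha hk i j
    nlinarith

/-! ### Stability of the recursions -/

/-- The weighted error of the degree recursion is a convex combination of earlier errors, up to
sources of order `1 / Δ n` at finitely many indices; each of these raises the bound once. -/
theorem bounded_of_degree_recursion {w Δ : ℕ → ℝ} {f : ℕ → ℕ → ℝ} {C : ℝ} {N K : ℕ}
    (hw : ∀ i, 0 < w i) (hΔ : ∀ n, 0 < Δ n)
    (h1 : ∀ n i, |f (n + 1) i - ((1 - w i / Δ n) * f n i +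
      prev (fun i => w i * f n i) i / Δ n)| ≤ if i < K then C / Δ n else 0)
    (h2 : ∀ n, N ≤ n → ∀ i, Δ n < w i → w i * |f (n + 1) i| ≤ C)
    (h3 : ∀ n, ∃ C', ∀ i, w i * |f n i| ≤ C') :
    ∃ B, ∀ n i, w i * |f n i| ≤ B := by
  choose C' hC' using h3
  have hC0 : 0 ≤ |C| := abs_nonneg C
  set B : ℝ := |C| + ∑ n ∈ Finset.range (N + 1), |C' n| with hB
  have hsum : 0 ≤ ∑ n ∈ Finset.range (N + 1), |C' n| := Finset.sum_nonneg fun _ _ => abs_nonneg _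
  have hCB : |C| ≤ B := by linarith
  have hsmall : ∀ n, n ≤ N → ∀ i, w i * |f n i| ≤ B := by
    intro n hn i
    have := Finset.single_le_sum (f := fun n => |C' n|) (fun _ _ => abs_nonneg _)
      (Finset.mem_range.2 (Nat.lt_succ_of_le hn))
    exact (hC' n i).trans ((le_abs_self _).trans (by linarith))
  have key : ∀ m, ∀ i, w i * |f (N + m) i| ≤ B + |C| * (min i K : ℕ) := by
    intro m
    induction m with
    | zero =>
      intro i
      have := hsmall N le_rfl i
      have : 0 ≤ |C| * (min i K : ℕ) := by positivity
      simp only [add_zero]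
      linarith
    | succ m ih =>
      intro i
      have hnn : 0 ≤ |C| * (min i K : ℕ) := by positivity
      rcases lt_or_ge (Δ (N + m)) (w i) with hlt | hge
      · have := h2 (N + m) (Nat.le_add_right _ _) i hlt
        have := le_abs_self C
        rw [← add_assoc]
        linarith
      · have hd := hΔ (N + m)
        have hx0 : 0 ≤ 1 - w i / Δ (N + m) := by
          rw [sub_nonneg, div_le_one hd]; exact hge
        have hx : 0 ≤ w i / Δ (N + m) := (div_pos (hw i) hd).le
        have hf : |f (N + m + 1) i| ≤ (1 - w i / Δ (N + m)) * |f (N + m) i| +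
            |prev (fun i => w i * f (N + m) i) i| / Δ (N + m) +
            if i < K then C / Δ (N + m) else 0 := by
          have h := h1 (N + m) i
          have e1 : |(1 - w i / Δ (N + m)) * f (N + m) i| =
              (1 - w i / Δ (N + m)) * |f (N + m) i| := by rw [abs_mul, abs_of_nonneg hx0]
          have e2 : |prev (fun i => w i * f (N + m) i) i / Δ (N + m)| =
              |prev (fun i => w i * f (N + m) i) i| / Δ (N + m) := by rw [abs_div, abs_of_pos hd]
          have e3 := abs_add_le ((1 - w i / Δ (N + m)) * f (N + m) i)
            (prev (fun i => w i * f (N + m) i) i / Δ (N + m))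
          have e4 := abs_sub_abs_le_abs_sub (f (N + m + 1) i) ((1 - w i / Δ (N + m)) * f (N + m) i +
            prev (fun i => w i * f (N + m) i) i / Δ (N + m))
          linarith
        have hih := ih i
        have hsrc : (if i < K then C / Δ (N + m) else 0) ≤
            (if i < K then |C| else 0) / Δ (N + m) := by
          split_ifs
          · exact div_le_div_of_nonneg_right (le_abs_self C) hd.le
          · simp
        have hmain : |prev (fun i => w i * f (N + m) i) i| + (if i < K then |C| else 0) ≤
            B + |C| * (min i K : ℕ) := by
          cases i with
          | zero =>
            simp only [prev, abs_zero, zero_add, Nat.zero_min, Nat.cast_zero, mul_zero, add_zero]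
            split_ifs <;> linarith
          | succ i =>
            have h4 := ih i
            simp only [prev]
            rw [abs_mul, abs_of_pos (hw i)]
            split_ifs with hi
            · rw [min_eq_left (by omega : i ≤ K)] at h4
              rw [min_eq_left hi.le]
              push_cast
              linarith
            · have : (min i K : ℕ) ≤ (min (i + 1) K : ℕ) := by omega
              have : ((min i K : ℕ) : ℝ) ≤ ((min (i + 1) K : ℕ) : ℝ) := by exact_mod_cast this
              nlinarith
        calc w i * |f (N + (m + 1)) i|
            ≤ w i * ((1 - w i / Δ (N + m)) * |f (N + m) i| +
              (|prev (fun i => w i * f (N + m) i) i| + (if i < K then |C| else 0)) / Δ (N + m)) := by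
              refine mul_le_mul_of_nonneg_left ?_ (hw i).le
              rw [add_div, ← add_assoc]
              exact hf.trans (by linarith)
          _ = (1 - w i / Δ (N + m)) * (w i * |f (N + m) i|) + w i / Δ (N + m) *
              (|prev (fun i => w i * f (N + m) i) i| + (if i < K then |C| else 0)) := by ring
          _ ≤ (1 - w i / Δ (N + m)) * (B + |C| * (min i K : ℕ)) + w i / Δ (N + m) *
              (B + |C| * (min i K : ℕ)) :=
              add_le_add (mul_le_mul_of_nonneg_left hih hx0) (mul_le_mul_of_nonneg_left hmain hx)
          _ = _ := by ring
  refine ⟨B + |C| * K, fun n i => ?_⟩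
  rcases le_total n N with h | h
  · have := hsmall n h i
    have : 0 ≤ |C| * K := by positivity
    linarith
  · obtain ⟨m, rfl⟩ := Nat.exists_eq_add_of_le h
    refine (key m i).trans ?_
    have : ((min i K : ℕ) : ℝ) ≤ K := by exact_mod_cast min_le_right _ _
    nlinarith

/-- The recursion for edges loses a fixed multiple of `1 / Δ n` of the error in each step, which
absorbs sources of order `1 / Δ n`. -/
theorem bounded_of_edge_recursion {w Δ : ℕ → ℝ} {f : ℕ → ℕ → ℕ → ℝ} {C : ℝ} {N : ℕ}
    (hw : ∀ i, 0 < w i) (hw' : ∀ i, w (i + 1) = w i + 1) (hΔ : ∀ n, 0 < Δ n)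
    (h1 : ∀ n i j, |f (n + 1) i j - ((1 - (w i + w j) / Δ n) * f n i j +
      prev (fun i => w i * f n i j) i / Δ n + prev (fun j => w j * f n i j) j / Δ n)| ≤ C / Δ n)
    (h2 : ∀ n, N ≤ n → ∀ i j, Δ n < w i + w j → |f (n + 1) i j| ≤ C)
    (h3 : ∀ n, ∃ C', ∀ i j, |f n i j| ≤ C') :
    ∃ B, ∀ n i j, |f n i j| ≤ B := by
  choose C' hC' using h3
  set η : ℝ := min 1 (w 0) with hη
  have hη0 : 0 < η := lt_min one_pos (hw 0)
  have hC0 : 0 ≤ |C| := abs_nonneg C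
  set B : ℝ := |C| + |C| / η + ∑ n ∈ Finset.range (N + 1), |C' n| with hB
  have hsum : 0 ≤ ∑ n ∈ Finset.range (N + 1), |C' n| := Finset.sum_nonneg fun _ _ => abs_nonneg _
  have hCη : 0 ≤ |C| / η := by positivity
  have hB0 : 0 ≤ B := by positivity
  have hBη : |C| ≤ B * η := by
    have : |C| / η ≤ B := by linarith
    rwa [div_le_iff₀ hη0] at this
  have hsmall : ∀ n, n ≤ N → ∀ i j, |f n i j| ≤ B := by
    intro n hn i j
    have := Finset.single_le_sum (f := fun n => |C' n|) (fun _ _ => abs_nonneg _)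
      (Finset.mem_range.2 (Nat.lt_succ_of_le hn))
    exact (hC' n i j).trans ((le_abs_self _).trans (by linarith))
  have hprev : ∀ g : ℕ → ℝ, (∀ i, |g i| ≤ B) → ∀ i,
      |prev (fun i => w i * g i) i| ≤ B * (w i - η) := by
    intro g hg i
    cases i with
    | zero =>
      have : η ≤ w 0 := min_le_right _ _
      simp only [prev, abs_zero]
      exact mul_nonneg hB0 (by linarith)
    | succ i =>
      have : η ≤ 1 := min_le_left _ _
      simp only [prev]
      rw [abs_mul, abs_of_pos (hw i), hw']
      have := mul_le_mul_of_nonneg_left (hg i) (hw i).le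
      nlinarith
  have key : ∀ m, ∀ i j, |f (N + m) i j| ≤ B := by
    intro m
    induction m with
    | zero => exact hsmall N le_rfl
    | succ m ih =>
      intro i j
      rcases lt_or_ge (Δ (N + m)) (w i + w j) with hlt | hge
      · have := h2 (N + m) (Nat.le_add_right _ _) i j hlt
        have := le_abs_self C
        rw [← add_assoc]
        linarith
      · have hd := hΔ (N + m)
        have hx0 : 0 ≤ 1 - (w i + w j) / Δ (N + m) := by
          rw [sub_nonneg, div_le_one hd]; exact hge
        have h := h1 (N + m) i j
        have e1 : |(1 - (w i + w j) / Δ (N + m)) * f (N + m) i j| ≤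
            (1 - (w i + w j) / Δ (N + m)) * B := by
          rw [abs_mul, abs_of_nonneg hx0]
          exact mul_le_mul_of_nonneg_left (ih i j) hx0
        have e2 : |prev (fun i => w i * f (N + m) i j) i / Δ (N + m)| ≤
            B * (w i - η) / Δ (N + m) := by
          rw [abs_div, abs_of_pos hd]
          exact div_le_div_of_nonneg_right (hprev (fun i => f (N + m) i j) (fun i => ih i j) i) hd.le
        have e3 : |prev (fun j => w j * f (N + m) i j) j / Δ (N + m)| ≤
            B * (w j - η) / Δ (N + m) := by
          rw [abs_div, abs_of_pos hd]
          exact div_le_div_of_nonneg_right (hprev (fun j => f (N + m) i j) (fun j => ih i j) j) hd.le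
        have e4 := abs_add_three ((1 - (w i + w j) / Δ (N + m)) * f (N + m) i j)
          (prev (fun i => w i * f (N + m) i j) i / Δ (N + m))
          (prev (fun j => w j * f (N + m) i j) j / Δ (N + m))
        have e5 := abs_sub_abs_le_abs_sub (f (N + m + 1) i j)
          ((1 - (w i + w j) / Δ (N + m)) * f (N + m) i j +
            prev (fun i => w i * f (N + m) i j) i / Δ (N + m) +
            prev (fun j => w j * f (N + m) i j) j / Δ (N + m))
        have e6 : C / Δ (N + m) ≤ B * η / Δ (N + m) :=
          div_le_div_of_nonneg_right ((le_abs_self C).trans hBη) hd.le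
        have e7 : (1 - (w i + w j) / Δ (N + m)) * B + B * (w i - η) / Δ (N + m) +
            B * (w j - η) / Δ (N + m) + B * η / Δ (N + m) = B - B * η / Δ (N + m) := by ring
        have e8 : 0 ≤ B * η / Δ (N + m) := by positivity
        rw [← add_assoc]
        linarith
  refine ⟨B, fun n i j => ?_⟩
  rcases le_total n N with h | h
  · exact hsmall n h i j
  · obtain ⟨m, rfl⟩ := Nat.exists_eq_add_of_le h
    exact key m i j

/-! ### The expected degree counts and edge counts -/

theorem atZero_nonneg (i : ℕ) : 0 ≤ atZero i := by unfold atZero; split_ifs <;> norm_num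

theorem atZero_le_one (i : ℕ) : atZero i ≤ 1 := by unfold atZero; split_ifs <;> norm_num

theorem den_succ (a : ℝ) (n : ℕ) : den a (n + 1) = den a n + (a + 1) := by
  unfold den; push_cast; ring

theorem le_den (n : ℕ) : a * (n + 1) ≤ den a n := by
  have : (0 : ℝ) ≤ n := n.cast_nonneg
  unfold den; linarith

/-- The normalizations within one group are comparable. -/
theorem inv_den_le (ha : 0 < a) {c r n : ℕ} (hn : n ≤ c * k + k) (x : ℝ) (hx : 0 ≤ x) :
    x / den a (c * k + r) ≤ (1 + (a + 1) * k / a) * x / den a n := by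
  have h1 := den_pos ha n
  have h2 := den_pos ha (c * k + r)
  have h3 : (n : ℝ) ≤ c * k + k := by exact_mod_cast hn
  have h4 : den a n ≤ (1 + (a + 1) * k / a) * den a (c * k + r) := by
    have h5 := le_den (a := a) (c * k + r)
    push_cast at h5
    have h6 : (0 : ℝ) ≤ (c : ℝ) * k := by positivity
    have h7 : (0 : ℝ) ≤ r := r.cast_nonneg
    have h8 : a ≤ den a (c * k + r) := by nlinarith
    have h9 : (a + 1) * k ≤ (a + 1) * k / a * den a (c * k + r) := by
      rw [div_mul_eq_mul_div, le_div_iff₀ ha]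
      exact mul_le_mul_of_nonneg_left h8 (by positivity)
    have h10 : den a n ≤ den a (c * k + r) + (a + 1) * k := by
      unfold den
      push_cast
      nlinarith
    linarith
  rw [div_le_div_iff₀ h2 h1]
  nlinarith

/-- One step of the process either increases the position in the current group by one or completes
the group. -/
theorem mod_succ_sub_mod (k n : ℕ) :
    (((n + 1) % k : ℕ) : ℝ) - (n % k : ℕ) = 1 - if k ∣ n + 1 then (k : ℝ) else 0 := by
  have h1 := Nat.div_add_mod (n + 1) k
  have h2 := Nat.div_add_mod n k
  rw [Nat.succ_div] at h1
  have h1' : ((k * (n / k + if k ∣ n + 1 then 1 else 0) + (n + 1) % k : ℕ) : ℝ) = n + 1 := by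
    rw [h1]; push_cast; ring
  have h2' : ((k * (n / k) + n % k : ℕ) : ℝ) = n := by rw [h2]
  push_cast at h1' h2'
  split_ifs at h1' ⊢
  · linarith
  · linarith

theorem succ_eq_of_dvd (h : k ∣ n + 1) : n + 1 = n / k * k + k := by
  have h1 := Nat.div_mul_cancel h
  rw [Nat.succ_div_of_dvd h] at h1
  linarith

theorem mod_le (hk : 1 ≤ k) (n : ℕ) : ((n % k : ℕ) : ℝ) ≤ k := by
  exact_mod_cast (Nat.mod_lt n (by omega)).le

theorem prev_sub (g h : ℕ → ℝ) (i : ℕ) : prev (fun i => g i - h i) i = prev g i - prev h i := by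
  cases i <;> simp [prev]

/-- The approximation to `expDeg`. It is linear in `den a n`, so that the recursion holds exactly,
and the second term spreads the completion of a group over its `k` steps. -/
noncomputable def approxDeg (a : ℝ) (k n i : ℕ) : ℝ :=
  rho a k i * (den a n / (a + 1)) - (n % k : ℕ) / k * atZero i

theorem approxDeg_succ (ha : 0 < a) (hk : 1 ≤ k) (n i : ℕ) :
    approxDeg a k (n + 1) i = (1 - wt a k i / den a n) * approxDeg a k n i +
      prev (fun i => wt a k i * approxDeg a k n i) i / den a n +
      (if k ∣ n + 1 then atZero i else 0) -
      (n % k : ℕ) / k * (wt a k i * atZero i - prev (fun i => wt a k i * atZero i) i) /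
        den a n := by
  have hk' : (1 : ℝ) ≤ k := by exact_mod_cast hk
  have hd := den_pos ha n
  have h := rho_eq ha hk i
  have hm := mod_succ_sub_mod k n
  have hp : prev (fun i => wt a k i * approxDeg a k n i) i =
      flow a k i * (den a n / (a + 1)) -
        prev (fun i => wt a k i * atZero i) i * ((n % k : ℕ) / k) := by
    unfold flow
    rw [← prev_mul_const, ← prev_mul_const, ← prev_sub]
    congr 1; ext i; unfold approxDeg; ring
  have hm' : (((n + 1) % k : ℕ) : ℝ) = (n % k : ℕ) + 1 - if k ∣ n + 1 then (k : ℝ) else 0 := by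
    linarith
  have hδ : (if k ∣ n + 1 then atZero i else 0) =
      (if k ∣ n + 1 then (k : ℝ) else 0) / k * atZero i := by
    split_ifs
    · field_simp
    · simp
  have hf : flow a k i = rho a k i * (wt a k i + a + 1) - atZero i * (a + 1) / k := by linarith
  rw [hp, hδ, hf, approxDeg, approxDeg, den_succ, hm']
  field_simp
  ring

theorem exists_abs_expDeg_sub_le (ha : 0 < a) (hk : 1 ≤ k) :
    ∃ B, ∀ n i, wt a k i * |expDeg a k n i - approxDeg a k n i| ≤ B := by
  have hk' : (1 : ℝ) ≤ k := by exact_mod_cast hk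
  have hw0 := wt_pos ha hk 0
  obtain ⟨K, hK, hKρ⟩ := exists_rho_le ha hk
  set C1 : ℝ := (1 + (a + 1) * k / a) * (k * (k + k * a)) + wt a k 0 with hC1
  have hC1' : 0 ≤ C1 := by positivity
  have hmk : ∀ n : ℕ, 0 ≤ ((n % k : ℕ) : ℝ) / k ∧ ((n % k : ℕ) : ℝ) / k ≤ 1 := fun n =>
    ⟨by positivity, (div_le_one (by linarith)).2 (mod_le hk n)⟩
  have hzw : ∀ n i, wt a k i * ((n % k : ℕ) / k * atZero i) ≤ wt a k 0 ∧
      0 ≤ wt a k i * ((n % k : ℕ) / k * atZero i) := by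
    intro n i
    obtain ⟨h1, h2⟩ := hmk n
    refine ⟨?_, by have := wt_pos ha hk i; have := atZero_nonneg i; positivity⟩
    cases i with
    | zero => simp only [atZero, if_true]; nlinarith
    | succ i => simp only [atZero, Nat.succ_ne_zero, if_false, mul_zero]; exact hw0.le
  have happ : ∀ n i, wt a k i * |approxDeg a k n i| ≤
      wt a k i * rho a k i * (den a n / (a + 1)) + wt a k 0 := by
    intro n i
    have hw := wt_pos ha hk i
    have hr := rho_pos ha hk i
    have hd := den_pos ha n
    have h1 : |approxDeg a k n i| ≤
        rho a k i * (den a n / (a + 1)) + (n % k : ℕ) / k * atZero i := by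
      refine (abs_sub _ _).trans ?_
      rw [abs_of_nonneg (by positivity : 0 ≤ rho a k i * (den a n / (a + 1))),
        abs_of_nonneg (by have := atZero_nonneg i; positivity)]
    have h2 := mul_le_mul_of_nonneg_left h1 hw.le
    have h3 := (hzw n i).1
    rw [mul_add] at h2
    linarith
  have hwρ : ∀ i, wt a k i * rho a k i ≤ K := by
    intro i
    have hw := wt_pos ha hk i
    have hr := rho_pos ha hk i
    have := hKρ i
    nlinarith [mul_pos (mul_pos hw hw) hr]
  refine bounded_of_degree_recursion (w := wt a k) (Δ := den a) (C := C1 + K + wt a k 0)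
    (N := ⌈(1 + k * a) / a⌉₊) (K := k + 2) (wt_pos ha hk) (den_pos ha) ?_ ?_ ?_
  · intro n i
    have hd := den_pos ha n
    have hp : prev (fun i => wt a k i * (expDeg a k n i - approxDeg a k n i)) i =
        prev (fun i => wt a k i * expDeg a k n i) i -
          prev (fun i => wt a k i * approxDeg a k n i) i := by
      rw [← prev_sub]; congr 1; ext i; ring
    have heq : expDeg a k (n + 1) i - approxDeg a k (n + 1) i -
        ((1 - wt a k i / den a n) * (expDeg a k n i - approxDeg a k n i) +
          prev (fun i => wt a k i * (expDeg a k n i - approxDeg a k n i)) i / den a n) =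
        (if k ∣ n + 1 then meanM a k (n + 1) (fun M => ind k (M.deg (n / k)) i) - atZero i
          else 0) +
        (n % k : ℕ) / k * (wt a k i * atZero i - prev (fun i => wt a k i * atZero i) i) /
          den a n := by
      rw [hp, expDeg_succ ha hk, approxDeg_succ ha hk]
      split_ifs <;> ring
    rw [heq]
    have hA : |if k ∣ n + 1 then meanM a k (n + 1) (fun M => ind k (M.deg (n / k)) i) - atZero i
        else 0| ≤ if i < k + 2 then
          (1 + (a + 1) * k / a) * (k * (k + k * a)) / den a n else 0 := by
      by_cases hdvd : k ∣ n + 1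
      · have hn := succ_eq_of_dvd hdvd
        rw [if_pos hdvd]
        split_ifs with hi
        · have h1 := abs_meanM_ind_sub_le (k := k) ha (n / k) i
          rw [← hn, ← mul_div_assoc] at h1
          refine h1.trans ?_
          have := inv_den_le (k := k) (r := 0) ha (show n ≤ n / k * k + k by omega)
            (k * (k + k * a)) (by positivity)
          rwa [add_zero] at this
        · have h1 := meanM_ind_eq_zero (a := a) (k := k) (n / k) (show k < i by omega)
          rw [← hn] at h1
          rw [h1, atZero, if_neg (by omega)]
          simp
      · rw [if_neg hdvd, abs_zero]
        split_ifs
        · positivity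
        · exact le_rfl
    have hB : |(n % k : ℕ) / k * (wt a k i * atZero i - prev (fun i => wt a k i * atZero i) i) /
        den a n| ≤ if i < k + 2 then wt a k 0 / den a n else 0 := by
      obtain ⟨h1, h2⟩ := hmk n
      have hc : |wt a k i * atZero i - prev (fun i => wt a k i * atZero i) i| ≤
          if i < k + 2 then wt a k 0 else 0 := by
        match i with
        | 0 => simp [atZero, prev, abs_of_pos hw0]
        | 1 => simp [atZero, prev, abs_of_pos hw0]
        | i + 2 =>
          simp only [atZero, prev, Nat.succ_ne_zero, if_false, mul_zero, sub_self, abs_zero]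
          split_ifs
          · exact hw0.le
          · exact le_rfl
      rw [abs_div, abs_of_pos hd, abs_mul, abs_of_nonneg h1]
      have : (if i < k + 2 then wt a k 0 / den a n else 0) =
          (if i < k + 2 then wt a k 0 else 0) / den a n := by split_ifs <;> simp
      rw [this]
      refine div_le_div_of_nonneg_right ((mul_le_of_le_one_left (abs_nonneg _) h2).trans hc) hd.le
    refine (abs_add_le _ _).trans ((add_le_add hA hB).trans ?_)
    split_ifs
    · rw [← add_div]
      refine div_le_div_of_nonneg_right ?_ hd.le
      rw [← hC1]
      linarith
    · simp
  · -- A degree of weight above `den a n` cannot occur once `n` is large: its excess over `k` is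
    -- more than `n + 1`. Only the density is left.
    intro n hn i hi
    have hN : (1 + k * a) / a ≤ n := (Nat.le_ceil _).trans (by exact_mod_cast hn)
    rw [div_le_iff₀ ha] at hN
    have hin : n + 1 < i := by
      have : ((n + 1 : ℕ) : ℝ) < i := by
        unfold den wt at hi; push_cast; nlinarith
      exact_mod_cast this
    have h0 : expDeg a k (n + 1) i = 0 :=
      meanM_numDeg_eq_zero hk (Nat.div_mul_le_self _ _) hin
    rw [h0, zero_sub, abs_neg]
    refine (happ _ _).trans ?_
    have hw := wt_pos ha hk i
    have hr := rho_pos ha hk i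
    have h2 : den a (n + 1) / (a + 1) ≤ wt a k i + 1 := by
      rw [div_le_iff₀ (by linarith), den_succ]
      nlinarith
    have h3 : wt a k i * rho a k i * (den a (n + 1) / (a + 1)) ≤ K := by
      refine le_trans (mul_le_mul_of_nonneg_left h2 (by positivity)) ?_
      linarith [hKρ i]
    linarith
  · intro n
    refine ⟨wt a k n * n + (K * (den a n / (a + 1)) + wt a k 0), fun i => ?_⟩
    have hw := wt_pos ha hk i
    have hd := den_pos ha n
    have h1 : wt a k i * |expDeg a k n i| ≤ wt a k n * n := by
      have h0 : 0 ≤ expDeg a k n i := meanM_nonneg ha (numDeg_nonneg _ _ _)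
      rw [abs_of_nonneg h0]
      rcases lt_or_ge n i with hi | hi
      · have : expDeg a k n i = 0 := meanM_numDeg_eq_zero hk (Nat.div_mul_le_self _ _) hi
        rw [this, mul_zero]
        have := wt_pos ha hk n
        positivity
      · have h2 : expDeg a k n i ≤ (n / k : ℕ) := meanM_numDeg_le ha _ _
        have h3 : ((n / k : ℕ) : ℝ) ≤ n := by exact_mod_cast Nat.div_le_self n k
        have h4 : wt a k i ≤ wt a k n := by
          have : (i : ℝ) ≤ n := by exact_mod_cast hi
          unfold wt; linarith
        exact mul_le_mul h4 (h2.trans h3) h0 (wt_pos ha hk n).le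
    have h2 := happ n i
    have h3 : wt a k i * rho a k i * (den a n / (a + 1)) ≤ K * (den a n / (a + 1)) :=
      mul_le_mul_of_nonneg_right (hwρ i) (by positivity)
    have h4 := mul_le_mul_of_nonneg_left (abs_sub (expDeg a k n i) (approxDeg a k n i)) hw.le
    rw [mul_add] at h4
    linarith

/-- The degree counts, in the form in which the recursions for edges use them. -/
theorem exists_abs_numDeg_sub_le (ha : 0 < a) (hk : 1 ≤ k) :
    ∃ B, ∀ c r, r < k → ∀ i, wt a k i * |meanM a k (c * k + r) (numDeg k c i) -
      rho a k i * (den a (c * k + r) / (a + 1))| ≤ B := by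
  obtain ⟨B, hB⟩ := exists_abs_expDeg_sub_le ha hk
  refine ⟨B + wt a k 0, fun c r hr i => ?_⟩
  have hk' : (1 : ℝ) ≤ k := by exact_mod_cast hk
  have hdiv : (c * k + r) / k = c := by
    rw [mul_comm, Nat.mul_add_div (by omega), Nat.div_eq_of_lt (by omega), add_zero]
  have h := hB (c * k + r) i
  rw [expDeg, hdiv, approxDeg] at h
  have hw := wt_pos ha hk i
  have hw0 := wt_pos ha hk 0
  set x := meanM a k (c * k + r) (numDeg k c i) - rho a k i * (den a (c * k + r) / (a + 1)) with hx
  set z : ℝ := ((c * k + r) % k : ℕ) / k with hz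
  have hz0 : 0 ≤ z := by positivity
  have hz1 : z ≤ 1 := (div_le_one (by linarith)).2 (mod_le hk _)
  have h1 : |x| ≤ |meanM a k (c * k + r) (numDeg k c i) -
      (rho a k i * (den a (c * k + r) / (a + 1)) - z * atZero i)| + z * atZero i := by
    have := abs_sub (meanM a k (c * k + r) (numDeg k c i) -
      (rho a k i * (den a (c * k + r) / (a + 1)) - z * atZero i)) (z * atZero i)
    rw [abs_of_nonneg (mul_nonneg hz0 (atZero_nonneg i))] at this
    refine le_trans (le_of_eq ?_) this
    congr 1
    rw [hx]; ring
  have h2 : wt a k i * (z * atZero i) ≤ wt a k 0 := by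
    cases i with
    | zero => simp only [atZero, if_true]; nlinarith
    | succ i => simp only [atZero, Nat.succ_ne_zero, if_false, mul_zero]; exact hw0.le
  have h3 := mul_le_mul_of_nonneg_left h1 hw.le
  rw [mul_add] at h3
  linarith

/-- The edges of the current group after `r` of its steps. -/
theorem exists_abs_numNew_sub_le (ha : 0 < a) (hk : 1 ≤ k) (r : ℕ) : r ≤ k →
    ∃ C, 0 ≤ C ∧ ∀ c j, wt a k j * meanM a k (c * k + r) (numNew k c j) ≤ C ∧
      |meanM a k (c * k + r) (numNew k c j) - r * (flow a k j / (a + 1))| ≤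
        C / den a (c * k) := by
  obtain ⟨B, hB⟩ := exists_abs_numDeg_sub_le ha hk
  obtain ⟨K, hK, hKρ⟩ := exists_rho_le ha hk
  have hk' : (1 : ℝ) ≤ k := by exact_mod_cast hk
  induction r with
  | zero =>
    intro _
    refine ⟨0, le_rfl, fun c j => ?_⟩
    have h0 : meanM a k (c * k + 0) (numNew k c j) = 0 := by
      refine meanM_eq_zero fun G => le_antisymm ?_ (numNew_nonneg _ _ _ _)
      simpa using numNew_le c (Nat.zero_le k) j G
    rw [h0]
    simp
  | succ r ih =>
    intro hr
    obtain ⟨C, hC0, hC⟩ := ih (by omega)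
    have hB0 : 0 ≤ B := (mul_nonneg (wt_pos ha hk 0).le (abs_nonneg _)).trans (hB 0 0 (by omega) 0)
    set K2 : ℝ := (1 + k * a) / a with hK2
    have hK20 : 0 < K2 := by positivity
    refine ⟨C + K2 * C + (K + K2 * B) + (3 * C + B), by positivity, fun c j => ?_⟩
    have hdiv : (c * k + r) / k = c := by
      rw [mul_comm, Nat.mul_add_div (by omega), Nat.div_eq_of_lt (by omega), add_zero]
    have hck : c * k ≤ c * k + r := Nat.le_add_right _ _
    have hstep := meanM_numNew_succ ha hk hdiv j
    have hY0 : ∀ j, 0 ≤ meanM a k (c * k + r) (numNew k c j) := fun j =>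
      meanM_nonneg ha (numNew_nonneg _ _ _)
    have hR0 : ∀ j, 0 ≤ meanM a k (c * k + r) (numDeg k c j) := fun j =>
      meanM_nonneg ha (numDeg_nonneg _ _ _)
    have hYz : ∀ j, c * k + r < j → meanM a k (c * k + r) (numNew k c j) = 0 := fun j =>
      meanM_numNew_eq_zero hk hck
    have hRz : ∀ j, c * k + r < j → meanM a k (c * k + r) (numDeg k c j) = 0 := fun j =>
      meanM_numDeg_eq_zero hk hck
    have hCj := hC c
    have hBj := hB c r (by omega)
    rw [← add_assoc, hstep]
    have hd := den_pos ha (c * k + r)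
    have hd0 := den_pos ha (c * k)
    have hdd := den_mono ha hck
    have hle := le_den (a := a) (c * k + r)
    have hwΔ : ∀ i, i ≤ c * k + r → wt a k (i + 1) ≤ K2 * den a (c * k + r) := by
      intro i hi
      have h1 : (i : ℝ) ≤ (c * k + r : ℕ) := by exact_mod_cast hi
      have h2 : (0 : ℝ) ≤ (c * k + r : ℕ) := Nat.cast_nonneg _
      have h3 : (0 : ℝ) ≤ k * a * (c * k + r : ℕ) := by positivity
      rw [hK2, div_mul_eq_mul_div, le_div_iff₀ ha, wt_succ]
      calc (wt a k i + 1) * a ≤ (1 + k * a) * (a * ((c * k + r : ℕ) + 1)) := by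
            unfold wt; nlinarith
        _ ≤ _ := mul_le_mul_of_nonneg_left hle (by positivity)
    set Y := fun j => meanM a k (c * k + r) (numNew k c j) with hY
    set R := fun j => meanM a k (c * k + r) (numDeg k c j) with hR
    set Δ := den a (c * k + r) with hΔ
    have hwj := wt_pos ha hk j
    constructor
    · -- The weight `wt j` is at most of order `Δ` wherever `Y` or `R` is not zero.
      have e1 : wt a k j * ((1 - wt a k j / Δ) * Y j) ≤ C := by
        have h1 := (hCj j).1
        have h2 : 0 ≤ wt a k j * (wt a k j / Δ * Y j) := by have := hY0 j; positivity
        change wt a k j * Y j ≤ C at h1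
        nlinarith
      have e2 : wt a k j * (prev (fun i => wt a k i * Y i) j / Δ) ≤ K2 * C := by
        cases j with
        | zero => simp only [prev, zero_div, mul_zero]; positivity
        | succ i =>
          simp only [prev]
          rcases lt_or_ge (c * k + r) i with hi | hi
          · rw [show Y i = 0 from hYz i hi, mul_zero, zero_div, mul_zero]; positivity
          · have h1 := (hCj i).1
            have h2 : wt a k (i + 1) / Δ ≤ K2 := (div_le_iff₀ hd).2 (hwΔ i hi)
            have h3 : 0 ≤ wt a k i * Y i := mul_nonneg (wt_pos ha hk i).le (hY0 i)
            calc wt a k (i + 1) * (wt a k i * Y i / Δ) = wt a k (i + 1) / Δ * (wt a k i * Y i) := by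
                  ring
              _ ≤ K2 * C := mul_le_mul h2 h1 h3 hK20.le
      have e3 : wt a k j * (prev (fun i => wt a k i * R i) j / Δ) ≤ K + K2 * B := by
        cases j with
        | zero => simp only [prev, zero_div, mul_zero]; positivity
        | succ i =>
          simp only [prev]
          rcases lt_or_ge (c * k + r) i with hi | hi
          · rw [show R i = 0 from hRz i hi, mul_zero, zero_div, mul_zero]; positivity
          · have hwi := wt_pos ha hk i
            have hρi := rho_pos ha hk i
            have h1 : wt a k i * R i ≤ wt a k i * rho a k i * (Δ / (a + 1)) + B := by
              have h4 := mul_le_mul_of_nonneg_left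
                (le_abs_self (R i - rho a k i * (Δ / (a + 1)))) hwi.le
              have h5 := hBj i
              change wt a k i * |R i - rho a k i * (Δ / (a + 1))| ≤ B at h5
              rw [mul_sub] at h4
              linarith
            have h2 : wt a k (i + 1) / Δ ≤ K2 := (div_le_iff₀ hd).2 (hwΔ i hi)
            have h3 : 0 ≤ wt a k (i + 1) / Δ := by positivity
            have h6 : wt a k (i + 1) / Δ * (wt a k i * rho a k i * (Δ / (a + 1))) ≤ K := by
              have h7 : wt a k (i + 1) / Δ * (wt a k i * rho a k i * (Δ / (a + 1))) =
                  (wt a k i * (wt a k i + 1) * rho a k i) / (a + 1) := by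
                rw [wt_succ]; field_simp
              rw [h7]
              exact (div_le_self (by positivity) (by linarith)).trans (hKρ i)
            have h8 : wt a k (i + 1) / Δ * B ≤ K2 * B := mul_le_mul_of_nonneg_right h2 hB0
            have h9 := mul_le_mul_of_nonneg_left h1 h3
            calc wt a k (i + 1) * (wt a k i * R i / Δ) = wt a k (i + 1) / Δ * (wt a k i * R i) := by
                  ring
              _ ≤ K + K2 * B := by linarith
      have : 0 ≤ 3 * C + B := by positivity
      calc _ = wt a k j * ((1 - wt a k j / Δ) * Y j) +
            wt a k j * (prev (fun i => wt a k i * Y i) j / Δ) +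
            wt a k j * (prev (fun i => wt a k i * R i) j / Δ) := by ring
        _ ≤ _ := by linarith
    · have hΔ0 : ∀ x, 0 ≤ x → x / Δ ≤ x / den a (c * k) := fun x hx =>
        div_le_div_of_nonneg_left hx hd0 hdd
      have e1 : |wt a k j * Y j / Δ| ≤ C / den a (c * k) := by
        rw [abs_of_nonneg (by have := hY0 j; positivity)]
        exact (div_le_div_of_nonneg_right (hCj j).1 hd.le).trans (hΔ0 C hC0)
      have e2 : |prev (fun i => wt a k i * Y i) j / Δ| ≤ C / den a (c * k) := by
        cases j with
        | zero => simp only [prev, zero_div, abs_zero]; positivity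
        | succ i =>
          simp only [prev]
          rw [abs_of_nonneg (by have := hY0 i; have := wt_pos ha hk i; positivity)]
          exact (div_le_div_of_nonneg_right (hCj i).1 hd.le).trans (hΔ0 C hC0)
      have e3 : |prev (fun i => wt a k i * R i) j / Δ - flow a k j / (a + 1)| ≤
          B / den a (c * k) := by
        cases j with
        | zero => simp only [prev, flow, zero_div, sub_self, abs_zero]; positivity
        | succ i =>
          have h5 := hBj i
          change wt a k i * |R i - rho a k i * (Δ / (a + 1))| ≤ B at h5
          simp only [prev, flow]
          have h6 : wt a k i * R i / Δ - wt a k i * rho a k i / (a + 1) =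
              wt a k i * (R i - rho a k i * (Δ / (a + 1))) / Δ := by field_simp
          rw [h6, abs_div, abs_of_pos hd, abs_mul, abs_of_pos (wt_pos ha hk i)]
          exact (div_le_div_of_nonneg_right h5 hd.le).trans (hΔ0 B hB0)
      have e4 := (hCj j).2
      change |Y j - r * (flow a k j / (a + 1))| ≤ _ at e4
      have e5 : 0 ≤ (C + K2 * C + (K + K2 * B)) / den a (c * k) := by positivity
      rw [add_div _ (3 * C + B)]
      have e6 : (3 * C + B) / den a (c * k) = C / den a (c * k) + C / den a (c * k) +
          C / den a (c * k) + B / den a (c * k) := by ring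
      have heq : (1 - wt a k j / Δ) * Y j + prev (fun i => wt a k i * Y i) j / Δ +
          prev (fun i => wt a k i * R i) j / Δ - ((r + 1 : ℕ) : ℝ) * (flow a k j / (a + 1)) =
          (Y j - r * (flow a k j / (a + 1))) + (-(wt a k j * Y j / Δ)) +
          prev (fun i => wt a k i * Y i) j / Δ +
          (prev (fun i => wt a k i * R i) j / Δ - flow a k j / (a + 1)) := by
        push_cast; ring
      rw [heq, e6]
      refine (abs_add_le _ _).trans ?_
      have h1 := abs_add_three (Y j - r * (flow a k j / (a + 1))) (-(wt a k j * Y j / Δ))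
        (prev (fun i => wt a k i * Y i) j / Δ)
      rw [abs_neg] at h1
      linarith

/-- The edges that a completed group brings along. -/
theorem exists_abs_completion_sub_le (ha : 0 < a) (hk : 1 ≤ k) :
    ∃ C, 0 ≤ C ∧ ∀ c i j,
      |meanM a k (c * k + k) (fun M => ind k (M.deg c) i * numNew k c j M) -
        atZero i * (k * (flow a k j / (a + 1)))| ≤ C / den a (c * k) := by
  obtain ⟨C, hC0, hC⟩ := exists_abs_numNew_sub_le ha hk k le_rfl
  refine ⟨2 * k * (k * (k + k * a)) + C, by positivity, fun c i j => ?_⟩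
  have h1 := abs_meanM_ind_mul_sub_le (k := k) ha c i j
  have h2 := (hC c j).2
  have h3 : |atZero i * meanM a k (c * k + k) (numNew k c j) -
      atZero i * (k * (flow a k j / (a + 1)))| ≤ C / den a (c * k) := by
    rw [← mul_sub, abs_mul, abs_of_nonneg (atZero_nonneg i)]
    exact (mul_le_of_le_one_left (abs_nonneg _) (atZero_le_one i)).trans h2
  refine (abs_sub_le _ _ _).trans ((add_le_add h1 h3).trans (le_of_eq ?_))
  ring

/-- The approximation to `expEdges`; the second term spreads the completion of a group over its `k`
steps. -/
noncomputable def approxEdges (a : ℝ) (k n i j : ℕ) : ℝ :=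
  edgeDensity a k i j * (den a n / (a + 1)) - (n % k : ℕ) * source a k i j

theorem approxEdges_succ (ha : 0 < a) (hk : 1 ≤ k) (n i j : ℕ) :
    approxEdges a k (n + 1) i j = (1 - (wt a k i + wt a k j) / den a n) * approxEdges a k n i j +
      prev (fun i => wt a k i * approxEdges a k n i j) i / den a n +
      prev (fun j => wt a k j * approxEdges a k n i j) j / den a n +
      (if k ∣ n + 1 then k * source a k i j else 0) -
      (n % k : ℕ) * ((wt a k i + wt a k j) * source a k i j -
        prev (fun i => wt a k i * source a k i j) i -
        prev (fun j => wt a k j * source a k i j) j) / den a n := by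
  have hd := den_pos ha n
  have h := edgeDensity_eq ha hk i j
  have hm := mod_succ_sub_mod k n
  have hp1 : prev (fun i => wt a k i * approxEdges a k n i j) i =
      prev (fun i => wt a k i * edgeDensity a k i j) i * (den a n / (a + 1)) -
        prev (fun i => wt a k i * source a k i j) i * (n % k : ℕ) := by
    rw [← prev_mul_const, ← prev_mul_const, ← prev_sub]
    congr 1; ext i; unfold approxEdges; ring
  have hp2 : prev (fun j => wt a k j * approxEdges a k n i j) j =
      prev (fun j => wt a k j * edgeDensity a k i j) j * (den a n / (a + 1)) -
        prev (fun j => wt a k j * source a k i j) j * (n % k : ℕ) := by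
    rw [← prev_mul_const, ← prev_mul_const, ← prev_sub]
    congr 1; ext j; unfold approxEdges; ring
  have hm' : (((n + 1) % k : ℕ) : ℝ) = (n % k : ℕ) + 1 - if k ∣ n + 1 then (k : ℝ) else 0 := by
    linarith
  have hδ : (if k ∣ n + 1 then k * source a k i j else 0) =
      (if k ∣ n + 1 then (k : ℝ) else 0) * source a k i j := by split_ifs <;> simp
  have hf : prev (fun i => wt a k i * edgeDensity a k i j) i =
      edgeDensity a k i j * (wt a k i + wt a k j + a + 1) -
        prev (fun j => wt a k j * edgeDensity a k i j) j - (a + 1) * source a k i j := by linarith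
  rw [hp1, hp2, hδ, hf, approxEdges, approxEdges, den_succ, hm']
  field_simp
  ring

theorem exists_abs_expEdges_sub_le (ha : 0 < a) (hk : 1 ≤ k) :
    ∃ B, ∀ n i j, |expEdges a k n i j - approxEdges a k n i j| ≤ B := by
  have hk' : (1 : ℝ) ≤ k := by exact_mod_cast hk
  obtain ⟨C, hC0, hC⟩ := exists_abs_completion_sub_le ha hk
  obtain ⟨Ks, hKs, hs⟩ := exists_source_le ha hk
  obtain ⟨Ke, hKe, he⟩ := exists_edgeDensity_le ha hk
  have hsw : ∀ i j, (wt a k i + wt a k j) * |source a k i j| ≤ Ks := fun i j => by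
    have := hs i j; have := abs_nonneg (source a k i j); linarith
  have hs1 : ∀ i j, |source a k i j| ≤ Ks := fun i j => by
    have := hs i j
    have := mul_nonneg (add_pos (wt_pos ha hk i) (wt_pos ha hk j)).le (abs_nonneg (source a k i j))
    linarith
  have he0 := edgeDensity_nonneg ha hk
  have he1 : ∀ i j, edgeDensity a k i j ≤ Ke := fun i j => by
    have := he i j
    have := mul_nonneg (he0 i j) (add_pos (wt_pos ha hk i) (wt_pos ha hk j)).le
    linarith
  have happ : ∀ n i j, |approxEdges a k n i j| ≤
      edgeDensity a k i j * (den a n / (a + 1)) + k * Ks := by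
    intro n i j
    have := he0 i j
    have hd := den_pos ha n
    refine (abs_sub _ _).trans ?_
    rw [abs_of_nonneg (by positivity : 0 ≤ edgeDensity a k i j * (den a n / (a + 1))), abs_mul,
      abs_of_nonneg (Nat.cast_nonneg _)]
    have := mul_le_mul (mod_le hk n) (hs1 i j) (abs_nonneg _) (by positivity)
    linarith
  set C1 : ℝ := (1 + (a + 1) * k / a) * (2 * C) + k * (3 * Ks) with hC1
  have hC10 : 0 ≤ C1 := by positivity
  refine bounded_of_edge_recursion (w := wt a k) (Δ := den a) (C := C1 + Ke + k * Ks)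
    (N := ⌈(1 + 2 * k * a) / a⌉₊) (wt_pos ha hk) (wt_succ a k) (den_pos ha) ?_ ?_ ?_
  · intro n i j
    have hd := den_pos ha n
    have hp1 : prev (fun i => wt a k i * (expEdges a k n i j - approxEdges a k n i j)) i =
        prev (fun i => wt a k i * expEdges a k n i j) i -
          prev (fun i => wt a k i * approxEdges a k n i j) i := by
      rw [← prev_sub]; congr 1; ext i; ring
    have hp2 : prev (fun j => wt a k j * (expEdges a k n i j - approxEdges a k n i j)) j =
        prev (fun j => wt a k j * expEdges a k n i j) j -
          prev (fun j => wt a k j * approxEdges a k n i j) j := by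
      rw [← prev_sub]; congr 1; ext i; ring
    have heq : expEdges a k (n + 1) i j - approxEdges a k (n + 1) i j -
        ((1 - (wt a k i + wt a k j) / den a n) * (expEdges a k n i j - approxEdges a k n i j) +
          prev (fun i => wt a k i * (expEdges a k n i j - approxEdges a k n i j)) i / den a n +
          prev (fun j => wt a k j * (expEdges a k n i j - approxEdges a k n i j)) j / den a n) =
        (if k ∣ n + 1 then
          meanM a k (n + 1) (fun M => ind k (M.deg (n / k)) i * numNew k (n / k) j M) +
          meanM a k (n + 1) (fun M => ind k (M.deg (n / k)) j * numNew k (n / k) i M) -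
            k * source a k i j else 0) +
        (n % k : ℕ) * ((wt a k i + wt a k j) * source a k i j -
          prev (fun i => wt a k i * source a k i j) i -
          prev (fun j => wt a k j * source a k i j) j) / den a n := by
      rw [hp1, hp2, expEdges_succ ha hk, approxEdges_succ ha hk]
      split_ifs <;> ring
    rw [heq]
    have hA : |if k ∣ n + 1 then
          meanM a k (n + 1) (fun M => ind k (M.deg (n / k)) i * numNew k (n / k) j M) +
          meanM a k (n + 1) (fun M => ind k (M.deg (n / k)) j * numNew k (n / k) i M) -
            k * source a k i j else 0| ≤ (1 + (a + 1) * k / a) * (2 * C) / den a n := by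
      by_cases hdvd : k ∣ n + 1
      · have hn := succ_eq_of_dvd hdvd
        rw [if_pos hdvd]
        have h1 := hC (n / k) i j
        have h2 := hC (n / k) j i
        rw [← hn] at h1 h2
        have hsrc : k * source a k i j = atZero i * (k * (flow a k j / (a + 1))) +
            atZero j * (k * (flow a k i / (a + 1))) := by unfold source; ring
        have h3 := inv_den_le (k := k) (r := 0) ha (show n ≤ n / k * k + k by omega)
            (2 * C) (by positivity)
        rw [add_zero] at h3
        refine le_trans ?_ h3
        rw [hsrc, add_sub_add_comm]
        refine (abs_add_le _ _).trans ((add_le_add h1 h2).trans (le_of_eq ?_))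
        ring
      · rw [if_neg hdvd, abs_zero]
        positivity
    have hprev1 : |prev (fun i => wt a k i * source a k i j) i| ≤ Ks := by
      cases i with
      | zero => simp only [prev, abs_zero]; exact hKs.le
      | succ i =>
        simp only [prev]
        rw [abs_mul, abs_of_pos (wt_pos ha hk i)]
        have := hsw i j
        have := mul_nonneg (wt_pos ha hk j).le (abs_nonneg (source a k i j))
        linarith
    have hprev2 : |prev (fun j => wt a k j * source a k i j) j| ≤ Ks := by
      cases j with
      | zero => simp only [prev, abs_zero]; exact hKs.le
      | succ j =>
        simp only [prev]
        rw [abs_mul, abs_of_pos (wt_pos ha hk j)]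
        have := hsw i j
        have := mul_nonneg (wt_pos ha hk i).le (abs_nonneg (source a k i j))
        linarith
    have hB : |(n % k : ℕ) * ((wt a k i + wt a k j) * source a k i j -
          prev (fun i => wt a k i * source a k i j) i -
          prev (fun j => wt a k j * source a k i j) j) / den a n| ≤ k * (3 * Ks) / den a n := by
      rw [abs_div, abs_of_pos hd, abs_mul, abs_of_nonneg (Nat.cast_nonneg _)]
      refine div_le_div_of_nonneg_right
        (mul_le_mul (mod_le hk n) ?_ (abs_nonneg _) (by positivity)) hd.le
      refine (abs_sub _ _).trans ((add_le_add (abs_sub _ _) le_rfl).trans ?_)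
      rw [abs_mul, abs_of_pos (add_pos (wt_pos ha hk i) (wt_pos ha hk j))]
      have := hsw i j
      linarith
    refine (abs_add_le _ _).trans ((add_le_add hA hB).trans ?_)
    rw [← add_div]
    refine div_le_div_of_nonneg_right ?_ hd.le
    rw [← hC1, add_assoc]
    exact le_add_of_nonneg_right (by positivity)
  · -- As for single nodes, degrees of total weight above `den a n` do not occur for large `n`.
    intro n hn i j hij
    have hN : (1 + 2 * k * a) / a ≤ n := (Nat.le_ceil _).trans (by exact_mod_cast hn)
    rw [div_le_iff₀ ha] at hN
    have hin : n + 1 < i + j := by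
      have : ((n + 1 : ℕ) : ℝ) < (i + j : ℕ) := by
        unfold den wt at hij; push_cast; nlinarith
      exact_mod_cast this
    have h0 : expEdges a k (n + 1) i j = 0 :=
      meanM_numEdges_eq_zero hk (Nat.div_mul_le_self _ _) hin
    rw [h0, zero_sub, abs_neg]
    refine (happ _ _ _).trans ?_
    have hwi := wt_pos ha hk i
    have hwj := wt_pos ha hk j
    have h2 : den a (n + 1) / (a + 1) ≤ wt a k i + wt a k j + 1 := by
      rw [div_le_iff₀ (by linarith), den_succ]
      nlinarith
    have h3 := (mul_le_mul_of_nonneg_left h2 (he0 i j)).trans (he i j)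
    linarith
  · intro n
    obtain ⟨C', hC'⟩ := exists_meanM_numEdges_le (k := k) ha n (n / k)
    refine ⟨C' + (Ke * (den a n / (a + 1)) + k * Ks), fun i j => ?_⟩
    have hd := den_pos ha n
    have h0 : 0 ≤ expEdges a k n i j := meanM_nonneg ha (numEdges_nonneg _ _ _ _)
    have h1 : expEdges a k n i j ≤ C' := hC' i j
    have h2 := happ n i j
    have h3 : edgeDensity a k i j * (den a n / (a + 1)) ≤ Ke * (den a n / (a + 1)) :=
      mul_le_mul_of_nonneg_right (he1 i j) (by positivity)
    have h4 := abs_sub (expEdges a k n i j) (approxEdges a k n i j)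
    rw [abs_of_nonneg h0] at h4
    linarith

/-- `E X(k + i, k + j, t)` is linear in `t` up to a uniformly
bounded error. -/
theorem exists_abs_meanM_numEdges_sub_le (ha : 0 < a) (hk : 1 ≤ k) :
    ∃ B, ∀ t i j, |meanM a k (k * t) (numEdges k t i j) - k * edgeDensity a k i j * t| ≤ B := by
  obtain ⟨B, hB⟩ := exists_abs_expEdges_sub_le ha hk
  obtain ⟨Ke, hKe, he⟩ := exists_edgeDensity_le ha hk
  refine ⟨B + Ke, fun t i j => ?_⟩
  have h := hB (k * t) i j
  have he0 := edgeDensity_nonneg ha hk i j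
  have he1 : edgeDensity a k i j ≤ Ke := by
    have := he i j
    have := mul_nonneg he0 (add_pos (wt_pos ha hk i) (wt_pos ha hk j)).le
    linarith
  rw [expEdges, Nat.mul_div_cancel_left _ (by omega), approxEdges, Nat.mul_mod_right, Nat.cast_zero,
    zero_mul, sub_zero] at h
  have h1 : edgeDensity a k i j * (den a (k * t) / (a + 1)) =
      k * edgeDensity a k i j * t + edgeDensity a k i j * (a / (a + 1)) := by
    unfold den; push_cast; field_simp; ring
  rw [h1] at h
  have h2 : 0 ≤ a / (a + 1) := by positivity
  have h3 : a / (a + 1) ≤ 1 := (div_le_one (by linarith)).2 (by linarith)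
  have h4 : edgeDensity a k i j * (a / (a + 1)) ≤ Ke := by nlinarith
  have h5 : 0 ≤ edgeDensity a k i j * (a / (a + 1)) := by positivity
  rw [abs_le] at h ⊢
  constructor <;> linarith [h.1, h.2]

theorem expEdges_zero_zero (ha : 0 < a) (hk : 1 ≤ k) (n : ℕ) : expEdges a k n 0 0 = 0 := by
  have hY : ∀ c r, r ≤ k → meanM a k (c * k + r) (numNew k c 0) = 0 := by
    intro c r
    induction r with
    | zero =>
      intro _
      refine meanM_eq_zero fun G => le_antisymm ?_ (numNew_nonneg _ _ _ _)
      simpa using numNew_le c (Nat.zero_le k) 0 G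
    | succ r ih =>
      intro hr
      have hdiv : (c * k + r) / k = c := by
        rw [mul_comm, Nat.mul_add_div (by omega), Nat.div_eq_of_lt (by omega), add_zero]
      rw [← add_assoc, meanM_numNew_succ ha hk hdiv, ih (by omega)]
      simp [prev]
  induction n with
  | zero => simp [expEdges, numEdges, meanM, mean]
  | succ n ih =>
    rw [expEdges_succ ha hk, ih]
    simp only [prev, mul_zero, zero_div, add_zero, zero_add]
    split_ifs with hdvd
    · have h0 : meanM a k (n + 1)
          (fun M => ind k (M.deg (n / k)) 0 * numNew k (n / k) 0 M) = 0 := by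
        refine le_antisymm ?_ (meanM_nonneg ha fun M =>
          mul_nonneg (ind_nonneg _ _ _) (numNew_nonneg _ _ _ _))
        have h1 := hY (n / k) k le_rfl
        rw [← succ_eq_of_dvd hdvd] at h1
        rw [← h1]
        exact meanM_mono ha fun M =>
          mul_le_of_le_one_left (numNew_nonneg _ _ _ _) (ind_le_one _ _ _)
      rw [h0, add_zero]
    · rfl

/-! ### The variance -/

/-- Two runs of the process whose edges have the same targets, except that a target in `{s, s'}` may
be replaced by another target in `{s, s'}`. -/
inductive Swap (s s' : ℕ) : {n : ℕ} → Graph1 n → Graph1 n → Prop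
  | refl {n : ℕ} (G : Graph1 n) : Swap s s' G G
  | attach {n : ℕ} {G G' : Graph1 n} (γ γ' : Fin (n + 1)) (h : Swap s s' G G')
      (hγ : γ = γ' ∨ (((γ : ℕ) = s ∨ (γ : ℕ) = s') ∧ ((γ' : ℕ) = s ∨ (γ' : ℕ) = s'))) :
      Swap s s' (.attach G γ) (.attach G' γ')

theorem Swap.deg_eq {s s' : ℕ} {G G' : Graph1 n} (h : Swap s s' G G') {v : ℕ} (hs : v ≠ s)
    (hs' : v ≠ s') : G.toMultigraph.deg v = G'.toMultigraph.deg v := by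
  induction h with
  | refl => rfl
  | attach γ γ' h hγ ih =>
    rw [deg_attach, deg_attach, ih]
    rcases hγ with rfl | hγ
    · rfl
    · rw [if_neg (by omega : ¬ v = (γ : ℕ)), if_neg (by omega : ¬ v = (γ' : ℕ))]

theorem Swap.deg_add_deg_eq {s s' : ℕ} {G G' : Graph1 n} (h : Swap s s' G G') :
    G.toMultigraph.deg s + G.toMultigraph.deg s' =
      G'.toMultigraph.deg s + G'.toMultigraph.deg s' := by
  induction h with
  | refl => rfl
  | attach γ γ' h hγ ih =>
    simp only [deg_attach]
    rcases hγ with rfl | hγ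
    · omega
    · split_ifs <;> omega

theorem Swap.deg_collapse_eq {s s' : ℕ} {G G' : Graph1 n} (h : Swap s s' G G') {v : ℕ}
    (hs : v ≠ s / k) (hs' : v ≠ s' / k) :
    (G.toMultigraph.collapse k).deg v = (G'.toMultigraph.collapse k).deg v := by
  induction h with
  | refl => rfl
  | attach γ γ' h hγ ih =>
    rw [deg_collapse_attach, deg_collapse_attach, ih]
    rcases hγ with rfl | ⟨hγ, hγ'⟩
    · rfl
    · rw [if_neg (by rcases hγ with h | h <;> rwa [h] : ¬ v = (γ : ℕ) / k),
        if_neg (by rcases hγ' with h | h <;> rwa [h] : ¬ v = (γ' : ℕ) / k)]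

theorem Swap.count_collapse_eq {s s' : ℕ} {G G' : Graph1 n} (h : Swap s s' G G') {u v : ℕ}
    (hus : u ≠ s / k) (hus' : u ≠ s' / k) (hvs : v ≠ s / k) (hvs' : v ≠ s' / k) :
    (G.toMultigraph.collapse k).edges.count s(u, v) =
      (G'.toMultigraph.collapse k).edges.count s(u, v) := by
  induction h with
  | refl => rfl
  | @attach n G G' γ γ' h hγ ih =>
    rw [count_collapse_attach, count_collapse_attach, ih]
    rcases hγ with rfl | ⟨hγ, hγ'⟩
    · rfl
    · have key : ∀ γ : ℕ, (γ = s ∨ γ = s') → ¬ s(u, v) = s(n / k, γ / k) := by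
        intro γ hγ
        rw [Sym2.eq_iff]
        rcases hγ with h | h <;> rw [h] <;> tauto
      rw [if_neg (key _ hγ), if_neg (key _ hγ')]

theorem Swap.targetProb_eq {s s' : ℕ} {G G' : Graph1 n} (h : Swap s s' G G') {γ : Fin (n + 1)}
    (hs : (γ : ℕ) ≠ s) (hs' : (γ : ℕ) ≠ s') : targetProb a G γ = targetProb a G' γ := by
  unfold targetProb
  rw [h.deg_eq hs hs']

theorem Swap.targetProb_add_eq {γ γ' : Fin (n + 1)} {G G' : Graph1 n}
    (h : Swap (γ : ℕ) (γ' : ℕ) G G') (hγ : (γ : ℕ) < n) (hγ' : (γ' : ℕ) < n) :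
    targetProb a G γ + targetProb a G γ' = targetProb a G' γ + targetProb a G' γ' := by
  have h1 := h.deg_add_deg_eq
  have h2 : (G.toMultigraph.deg γ : ℝ) + G.toMultigraph.deg γ' =
      G'.toMultigraph.deg γ + G'.toMultigraph.deg γ' := by exact_mod_cast h1
  unfold targetProb
  rw [if_pos hγ, if_pos hγ', if_pos hγ, if_pos hγ', ← add_div, ← add_div]
  congr 1
  linarith

/-- If two graphs agree away from two nodes, then edges away from these nodes contribute equally to
`X` in both graphs, and edges at these nodes contribute at most `2 (d₁ + d₂)`. -/
theorem X_le_add_of_eq_off {M M' : Multigraph} {S S' : ℕ}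
    (hdeg : ∀ v, v ≠ S → v ≠ S' → M.deg v = M'.deg v)
    (hcount : ∀ u v, u ≠ S → u ≠ S' → v ≠ S → v ≠ S' →
      M.edges.count s(u, v) = M'.edges.count s(u, v)) (d₁ d₂ t : ℕ) :
    M.X d₁ d₂ t ≤ M'.X d₁ d₂ t + 2 * (d₁ + d₂) := by
  set g : ℕ → ℕ → ℕ := fun u v =>
    if u ≠ v ∧ M.deg u = d₁ ∧ M.deg v = d₂ then M.edges.count s(u, v) else 0 with hg
  set g' : ℕ → ℕ → ℕ := fun u v =>
    if u ≠ v ∧ M'.deg u = d₁ ∧ M'.deg v = d₂ then M'.edges.count s(u, v) else 0 with hg'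
  have hpair : ∀ x : ℕ, ∑ u ∈ Finset.range t, (if u = S ∨ u = S' then x else 0) ≤ 2 * x := by
    intro x
    rw [← Finset.sum_filter, Finset.sum_const, smul_eq_mul]
    refine Nat.mul_le_mul_right _ (le_trans (Finset.card_le_card (t := {S, S'}) ?_)
      Finset.card_le_two)
    intro u hu
    simpa using (Finset.mem_filter.1 hu).2
  have h1 : ∑ u ∈ Finset.range t, ∑ v ∈ Finset.range t, (if u = S ∨ u = S' then g u v else 0) ≤
      2 * d₁ := by
    refine le_trans (Finset.sum_le_sum fun u _ => ?_) (hpair d₁)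
    by_cases hu : u = S ∨ u = S'
    · simp only [hu, if_true]
      by_cases hd : M.deg u = d₁
      · rw [← hd]
        refine le_trans (Finset.sum_le_sum fun v _ => ?_) (M.sum_count_le_deg (Finset.range t) u)
        simp only [hg]
        split_ifs <;> omega
      · simp [hg, hd]
    · simp [hu]
  have h2 : ∑ u ∈ Finset.range t, ∑ v ∈ Finset.range t, (if v = S ∨ v = S' then g u v else 0) ≤
      2 * d₂ := by
    rw [Finset.sum_comm]
    refine le_trans (Finset.sum_le_sum fun v _ => ?_) (hpair d₂)
    by_cases hv : v = S ∨ v = S'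
    · simp only [hv, if_true]
      by_cases hd : M.deg v = d₂
      · rw [← hd]
        refine le_trans (Finset.sum_le_sum fun u _ => ?_) (M.sum_count_le_deg (Finset.range t) v)
        simp only [hg]
        rw [Sym2.eq_swap (a := u)]
        split_ifs <;> omega
      · simp [hg, hd]
    · simp [hv]
  have h3 : ∀ u v, g u v ≤ g' u v + (if u = S ∨ u = S' then g u v else 0) +
      (if v = S ∨ v = S' then g u v else 0) := by
    intro u v
    by_cases hu : u = S ∨ u = S'
    · rw [if_pos hu]; omega
    · by_cases hv : v = S ∨ v = S'
      · rw [if_pos hv]; omega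
      · push Not at hu hv
        have : g u v = g' u v := by
          simp only [hg, hg']
          rw [hdeg u hu.1 hu.2, hdeg v hv.1 hv.2, hcount u v hu.1 hu.2 hv.1 hv.2]
        omega
  have h4 : M.X d₁ d₂ t ≤ ∑ u ∈ Finset.range t, ∑ v ∈ Finset.range t,
      (g' u v + (if u = S ∨ u = S' then g u v else 0) + (if v = S ∨ v = S' then g u v else 0)) :=
    Finset.sum_le_sum fun u _ => Finset.sum_le_sum fun v _ => h3 u v
  simp only [Finset.sum_add_distrib] at h4
  have h5 : M'.X d₁ d₂ t = ∑ u ∈ Finset.range t, ∑ v ∈ Finset.range t, g' u v := rfl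
  omega

theorem Swap.symm {s s' : ℕ} {G G' : Graph1 n} (h : Swap s s' G G') : Swap s s' G' G := by
  induction h with
  | refl G => exact .refl G
  | attach γ γ' _ hγ ih => exact .attach γ' γ ih (hγ.imp Eq.symm And.symm)

theorem Swap.abs_X_sub_le {s s' : ℕ} {G G' : Graph1 n} (h : Swap s s' G G') (d₁ d₂ t : ℕ) :
    |((G.toMultigraph.collapse k).X d₁ d₂ t : ℝ) - (G'.toMultigraph.collapse k).X d₁ d₂ t| ≤
      2 * (d₁ + d₂) := by
  have key : ∀ {G G' : Graph1 n}, Swap s s' G G' →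
      ((G.toMultigraph.collapse k).X d₁ d₂ t : ℝ) ≤
        (G'.toMultigraph.collapse k).X d₁ d₂ t + 2 * (d₁ + d₂) := by
    intro G G' h
    exact_mod_cast X_le_add_of_eq_off (S := s / k) (S' := s' / k)
      (fun v hs hs' => h.deg_collapse_eq hs hs')
      (fun u v h1 h2 h3 h4 => h.count_collapse_eq h1 h2 h3 h4) d₁ d₂ t
  have h1 := key h
  have h2 := key h.symm
  rw [abs_le]
  constructor <;> linarith

/-- The expectation of `F` after `r` more steps from the graph `G`. -/
noncomputable def future (a : ℝ) (F : Multigraph → ℝ) : ℕ → {n : ℕ} → Graph1 n → ℝ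
  | 0, _, G => F G.toMultigraph
  | r + 1, _, G => ∑ γ, targetProb a G γ * future a F r (.attach G γ)

/-- Two probability vectors that agree outside `{s, s'}` give almost the same expectation to
functions that are close at equal points and across the points `s` and `s'`. -/
theorem sum_sub_sum_le_of_eq_off {ι : Type*} [Fintype ι] [DecidableEq ι] {s s' : ι} (hss : s ≠ s')
    {P P' x x' : ι → ℝ} {B : ℝ} (hP : ∀ i, 0 ≤ P i) (hP' : ∀ i, 0 ≤ P' i) (hsum : ∑ i, P i = 1)
    (heq : ∀ i, i ≠ s → i ≠ s' → P i = P' i) (hadd : P s + P s' = P' s + P' s')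
    (hx : ∀ i, x i - x' i ≤ B)
    (hxs : ∀ i i', (i = s ∨ i = s') → (i' = s ∨ i' = s') → x i - x' i' ≤ B) :
    ∑ i, P i * x i - ∑ i, P' i * x' i ≤ B := by
  have hsplit : ∀ f : ι → ℝ, ∑ i, f i =
      f s + f s' + ∑ i ∈ (Finset.univ.erase s).erase s', f i := by
    intro f
    rw [← Finset.add_sum_erase _ f (Finset.mem_univ s), ← Finset.add_sum_erase _ f
      (Finset.mem_erase.2 ⟨hss.symm, Finset.mem_univ s'⟩), add_assoc]
  rw [hsplit] at hsum
  rw [hsplit fun i => P i * x i, hsplit fun i => P' i * x' i]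
  have h1 : ∑ i ∈ (Finset.univ.erase s).erase s', P i * x i -
      ∑ i ∈ (Finset.univ.erase s).erase s', P' i * x' i ≤
      (∑ i ∈ (Finset.univ.erase s).erase s', P i) * B := by
    rw [← Finset.sum_sub_distrib, Finset.sum_mul]
    refine Finset.sum_le_sum fun i hi => ?_
    simp only [Finset.mem_erase, Finset.mem_univ, and_true] at hi
    rw [← heq i hi.2 hi.1, ← mul_sub]
    exact mul_le_mul_of_nonneg_left (hx i) (hP i)
  set M := max (x s) (x s')
  set m := min (x' s) (x' s')
  have hMm : M - m ≤ B := by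
    rcases max_choice (x s) (x s') with h | h <;> rcases min_choice (x' s) (x' s') with h' | h' <;>
      simp only [M, m, h, h'] <;> exact hxs _ _ (by tauto) (by tauto)
  have h2 := mul_le_mul_of_nonneg_left (le_max_left (x s) (x s')) (hP s)
  have h3 := mul_le_mul_of_nonneg_left (le_max_right (x s) (x s')) (hP s')
  have h4 := mul_le_mul_of_nonneg_left (min_le_left (x' s) (x' s')) (hP' s)
  have h5 := mul_le_mul_of_nonneg_left (min_le_right (x' s) (x' s')) (hP' s')
  have h6 : (P s + P s') * (M - m) ≤ (P s + P s') * B :=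
    mul_le_mul_of_nonneg_left hMm (add_nonneg (hP s) (hP s'))
  have h7 : (P s + P s') * m = (P' s + P' s') * m := by rw [hadd]
  have h8 : (P s + P s' + ∑ i ∈ (Finset.univ.erase s).erase s', P i) * B = B := by
    rw [hsum, one_mul]
  simp only [M, m] at h6 h7
  nlinarith

/-- Moving one edge changes the expected final value of `F` by at most `B`, since the remaining steps
can be coupled so that they preserve the relation `Swap`. -/
theorem Swap.future_sub_le (ha : 0 < a) {F : Multigraph → ℝ} {B : ℝ} {s s' : ℕ} (hss : s ≠ s')
    (hF : ∀ {n : ℕ} {G G' : Graph1 n}, Swap s s' G G' → F G.toMultigraph - F G'.toMultigraph ≤ B)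
    (r : ℕ) : ∀ {n : ℕ} {G G' : Graph1 n}, s < n → s' < n → Swap s s' G G' →
      future a F r G - future a F r G' ≤ B := by
  induction r with
  | zero => intro n G G' _ _ h; exact hF h
  | succ r ih =>
    intro n G G' hs hs' h
    have ih' : ∀ γ γ' : Fin (n + 1),
        (γ = γ' ∨ (((γ : ℕ) = s ∨ (γ : ℕ) = s') ∧ ((γ' : ℕ) = s ∨ (γ' : ℕ) = s'))) →
        future a F r (.attach G γ) - future a F r (.attach G' γ') ≤ B := fun γ γ' hγ =>
      ih (by omega) (by omega) (.attach γ γ' h hγ)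
    have hval : ∀ γ : Fin (n + 1), ∀ m (hm : m < n + 1), γ = ⟨m, hm⟩ → (γ : ℕ) = m := by
      rintro γ m hm rfl; rfl
    refine sum_sub_sum_le_of_eq_off (s := ⟨s, by omega⟩) (s' := ⟨s', by omega⟩)
      (fun h => hss (Fin.mk.inj h)) (targetProb_nonneg ha G) (targetProb_nonneg ha G')
      (sum_targetProb ha G) (fun γ h1 h2 => h.targetProb_eq (fun h' => h1 (Fin.ext h'))
        (fun h' => h2 (Fin.ext h'))) ?_ (fun γ => ih' γ γ (Or.inl rfl)) ?_
    · exact Swap.targetProb_add_eq (γ := ⟨s, by omega⟩) (γ' := ⟨s', by omega⟩) h hs hs'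
    · intro γ γ' h1 h2
      exact ih' γ γ' (Or.inr ⟨h1.imp (hval _ _ _) (hval _ _ _), h2.imp (hval _ _ _) (hval _ _ _)⟩)

theorem mean_future (F : Multigraph → ℝ) (r : ℕ) : ∀ n : ℕ,
    mean a (fun G : Graph1 n => future a F r G) = mean a fun G : Graph1 (n + r) =>
      F G.toMultigraph := by
  induction r with
  | zero => intro n; rfl
  | succ r ih =>
    intro n
    have h := ih (n + 1)
    rw [mean_succ] at h
    have e : n + 1 + r = n + (r + 1) := by omega
    rw [← e]
    exact h

theorem sum_mul_sq_le {ι : Type*} [Fintype ι] {P x : ι → ℝ} {B : ℝ} (hP : ∀ i, 0 ≤ P i)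
    (hsum : ∑ i, P i = 1) (hx : ∀ i j, x i - x j ≤ B) :
    ∑ i, P i * x i ^ 2 ≤ (∑ i, P i * x i) ^ 2 + B ^ 2 := by
  set μ := ∑ i, P i * x i with hμ
  have h1 : ∀ i, x i - μ ≤ B := by
    intro i
    have : x i - μ = ∑ j, P j * (x i - x j) := by
      simp only [mul_sub]
      rw [Finset.sum_sub_distrib, ← Finset.sum_mul, hsum, one_mul]
    rw [this]
    calc _ ≤ ∑ j, P j * B := Finset.sum_le_sum fun j _ => mul_le_mul_of_nonneg_left (hx i j) (hP j)
      _ = B := by rw [← Finset.sum_mul, hsum, one_mul]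
  have h2 : ∀ i, μ - x i ≤ B := by
    intro i
    have : μ - x i = ∑ j, P j * (x j - x i) := by
      simp only [mul_sub]
      rw [Finset.sum_sub_distrib, ← Finset.sum_mul, hsum, one_mul]
    rw [this]
    calc _ ≤ ∑ j, P j * B := Finset.sum_le_sum fun j _ => mul_le_mul_of_nonneg_left (hx j i) (hP j)
      _ = B := by rw [← Finset.sum_mul, hsum, one_mul]
  have h3 : ∑ i, P i * x i ^ 2 = ∑ i, P i * (x i - μ) ^ 2 + μ ^ 2 := by
    have : ∀ i, P i * x i ^ 2 = P i * (x i - μ) ^ 2 + 2 * μ * (P i * x i) - μ ^ 2 * P i := by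
      intro i; ring
    simp only [this]
    rw [Finset.sum_sub_distrib, Finset.sum_add_distrib, ← Finset.mul_sum, ← Finset.mul_sum, hsum,
      ← hμ]
    ring
  have h4 : ∑ i, P i * (x i - μ) ^ 2 ≤ ∑ i, P i * B ^ 2 := by
    refine Finset.sum_le_sum fun i _ => mul_le_mul_of_nonneg_left ?_ (hP i)
    have := h1 i
    have := h2 i
    nlinarith
  rw [← Finset.sum_mul, hsum, one_mul] at h4
  linarith

/-- A function that changes by at most `B` when targets are exchanged between two nodes has variance
at most `n * B ^ 2`: the martingale of its conditional expectations has increments at most `B`. -/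
theorem mean_sq_le (ha : 0 < a) {F : Multigraph → ℝ} {B : ℝ} (hB : 0 ≤ B)
    (hF : ∀ {s s' n : ℕ} {G G' : Graph1 n}, Swap s s' G G' →
      F G.toMultigraph - F G'.toMultigraph ≤ B) (n : ℕ) :
    mean a (fun G : Graph1 n => F G.toMultigraph ^ 2) ≤
      mean a (fun G : Graph1 n => F G.toMultigraph) ^ 2 + n * B ^ 2 := by
  have hstep : ∀ (m r : ℕ), mean a (fun G : Graph1 (m + 1) => future a F r G ^ 2) ≤
      mean a (fun G : Graph1 m => future a F (r + 1) G ^ 2) + B ^ 2 := by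
    intro m r
    rw [mean_succ, ← mean_const (a := a) (n := m) ha (B ^ 2), ← mean_add]
    refine mean_mono ha fun G => sum_mul_sq_le (targetProb_nonneg ha G) (sum_targetProb ha G)
      fun γ γ' => ?_
    by_cases hγ : γ = γ'
    · rw [hγ, sub_self]; exact hB
    · exact Swap.future_sub_le ha (fun h => hγ (Fin.ext h)) hF r γ.2 γ'.2
        (.attach γ γ' (.refl G) (Or.inr ⟨Or.inl rfl, Or.inr rfl⟩))
  have hall : ∀ m r : ℕ, mean a (fun G : Graph1 m => future a F r G ^ 2) ≤
      mean a (fun G : Graph1 0 => future a F (r + m) G ^ 2) + m * B ^ 2 := by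
    intro m
    induction m with
    | zero => intro r; simp
    | succ m ih =>
      intro r
      have h1 := hstep m r
      have h2 := ih (r + 1)
      rw [add_right_comm, add_assoc] at h2
      push_cast
      linarith
  have h := hall n 0
  rw [zero_add] at h
  refine h.trans (add_le_add (le_of_eq ?_) le_rfl)
  have h2 := mean_future (a := a) F n 0
  rw [zero_add] at h2
  rw [← h2, mean_zero, mean_zero]

theorem meanM_X_sq_le (ha : 0 < a) (k n d₁ d₂ t : ℕ) :
    meanM a k n (fun M => (M.X d₁ d₂ t : ℝ) ^ 2) ≤
      meanM a k n (fun M => (M.X d₁ d₂ t : ℝ)) ^ 2 + n * (2 * (d₁ + d₂) : ℝ) ^ 2 :=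
  mean_sq_le (F := fun M => ((M.collapse k).X d₁ d₂ t : ℝ)) ha (by positivity)
    (fun h => (le_abs_self _).trans (h.abs_X_sub_le d₁ d₂ t)) n

/-! ### The lower bound for the edge density -/

/-- The product of `(x + 3 + l) / (x + a + 2 + l)` over `l < m`, a quotient of Gamma functions of
order `m ^ (1 - a)`. -/
noncomputable def gammaProd (a x : ℝ) (m : ℕ) : ℝ :=
  ∏ l ∈ Finset.range m, (x + 3 + l) / (x + a + 2 + l)

theorem gammaProd_pos (ha : 0 < a) {x : ℝ} (hx : 0 < x) (m : ℕ) : 0 < gammaProd a x m :=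
  Finset.prod_pos fun l _ => by positivity

theorem gammaProd_succ (a x : ℝ) (m : ℕ) :
    gammaProd a x (m + 1) = gammaProd a x m * ((x + 3 + m) / (x + a + 2 + m)) :=
  Finset.prod_range_succ _ _

theorem tendsto_gammaProd (ha : 0 < a) {x : ℝ} (hx : 0 < x) :
    Tendsto (fun m : ℕ => gammaProd a x (m + 1) * (m : ℝ) ^ (a - 1)) atTop
      (𝓝 (Real.Gamma (x + a + 2) / Real.Gamma (x + 3))) := by
  have h1 := Real.GammaSeq_tendsto_Gamma (x + a + 2)
  have h2 := Real.GammaSeq_tendsto_Gamma (x + 3)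
  have h3 := h1.div h2 (Real.Gamma_pos_of_pos (by positivity)).ne'
  refine h3.congr' ?_
  filter_upwards [eventually_gt_atTop 0] with m hm
  have hm' : (0 : ℝ) < m := by exact_mod_cast hm
  have hp1 : 0 < ∏ j ∈ Finset.range (m + 1), (x + a + 2 + j) :=
    Finset.prod_pos fun j _ => by positivity
  have hp2 : 0 < ∏ j ∈ Finset.range (m + 1), (x + 3 + j) :=
    Finset.prod_pos fun j _ => by positivity
  have hf : (0 : ℝ) < m.factorial := by exact_mod_cast m.factorial_pos
  have hpow : (m : ℝ) ^ (x + a + 2) = (m : ℝ) ^ (a - 1) * (m : ℝ) ^ (x + 3) := by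
    rw [← Real.rpow_add hm']; congr 1; ring
  have hpos : 0 < (m : ℝ) ^ (x + 3) := Real.rpow_pos_of_pos hm' _
  simp only [Pi.div_apply, Real.GammaSeq, gammaProd, Finset.prod_div_distrib]
  rw [hpow]
  field_simp

theorem exists_gammaProd_le (ha : 0 < a) {x y : ℝ} (hx : 0 < x) (hy : 0 < y) :
    ∃ K, 0 < K ∧ ∀ m, gammaProd a x m ≤ K * gammaProd a y m := by
  have hG : ∀ z : ℝ, 0 < z → 0 < Real.Gamma (z + a + 2) / Real.Gamma (z + 3) := fun z hz =>
    div_pos (Real.Gamma_pos_of_pos (by positivity)) (Real.Gamma_pos_of_pos (by positivity))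
  have h := (tendsto_gammaProd ha hx).div (tendsto_gammaProd ha hy) (hG y hy).ne'
  have h' := h.congr' (f₂ := fun m => gammaProd a x (m + 1) / gammaProd a y (m + 1)) (by
    filter_upwards [eventually_gt_atTop 0] with m hm
    have hm' : (0 : ℝ) < m := by exact_mod_cast hm
    have := Real.rpow_pos_of_pos hm' (a - 1)
    simp only [Pi.div_apply]
    rw [mul_div_mul_right _ _ this.ne'])
  obtain ⟨K, hK⟩ := ((tendsto_add_atTop_iff_nat
    (f := fun m => gammaProd a x m / gammaProd a y m) 1).1 h').bddAbove_range
  have hK' : ∀ m, gammaProd a x m / gammaProd a y m ≤ K := fun m => hK ⟨m, rfl⟩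
  refine ⟨K, (div_pos (gammaProd_pos ha hx 0) (gammaProd_pos ha hy 0)).trans_le (hK' 0), fun m => ?_⟩
  exact (div_le_iff₀ (gammaProd_pos ha hy m)).1 (hK' m)

theorem exists_rpow_le_gammaProd (ha : 0 < a) {x b : ℝ} (hx : 0 < x) (hb : 0 < b) :
    ∃ K, 0 < K ∧ ∀ m : ℕ, (m + b) ^ (1 - a) ≤ K * gammaProd a x m := by
  have hG : 0 < Real.Gamma (x + a + 2) / Real.Gamma (x + 3) :=
    div_pos (Real.Gamma_pos_of_pos (by positivity)) (Real.Gamma_pos_of_pos (by positivity))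
  have h1 : Tendsto (fun m : ℕ => ((1 + b) / (m : ℝ) + 1) ^ (1 - a)) atTop (𝓝 1) := by
    have : Tendsto (fun m : ℕ => (1 + b) / (m : ℝ) + 1) atTop (𝓝 (0 + 1)) :=
      (tendsto_const_div_atTop_nhds_zero_nat _).add_const _
    rw [zero_add] at this
    simpa using this.rpow_const (p := 1 - a) (Or.inl one_ne_zero)
  have h := h1.div (tendsto_gammaProd ha hx) hG.ne'
  have h' := h.congr' (f₂ := fun m => ((m + 1 : ℕ) + b) ^ (1 - a) / gammaProd a x (m + 1)) (by
    filter_upwards [eventually_gt_atTop 0] with m hm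
    have hm' : (0 : ℝ) < m := by exact_mod_cast hm
    have hp := Real.rpow_pos_of_pos hm' (a - 1)
    have hg := gammaProd_pos ha hx (m + 1)
    have e1 : ((m + 1 : ℕ) + b : ℝ) = ((1 + b) / (m : ℝ) + 1) * m := by
      push_cast; field_simp; ring
    have e2 : (m : ℝ) ^ (1 - a) = ((m : ℝ) ^ (a - 1))⁻¹ := by
      rw [← Real.rpow_neg hm'.le]; congr 1; ring
    simp only [Pi.div_apply]
    rw [e1, Real.mul_rpow (by positivity) hm'.le, e2]
    field_simp)
  obtain ⟨K, hK⟩ := ((tendsto_add_atTop_iff_nat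
    (f := fun m : ℕ => ((m : ℝ) + b) ^ (1 - a) / gammaProd a x m) 1).1 h').bddAbove_range
  have hK' : ∀ m : ℕ, ((m : ℝ) + b) ^ (1 - a) / gammaProd a x m ≤ K := fun m => hK ⟨m, rfl⟩
  refine ⟨K, (div_pos (Real.rpow_pos_of_pos (by positivity) _)
    (gammaProd_pos ha hx 0)).trans_le (hK' 0), fun m => ?_⟩
  exact (div_le_iff₀ (gammaProd_pos ha hx m)).1 (hK' m)

theorem rho_eq_gammaProd (ha : 0 < a) (hk : 1 ≤ k) (j : ℕ) :
    wt a k j * (wt a k j + 1) * (wt a k j + 2) * rho a k j =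
      wt a k 0 * (wt a k 0 + 1) * (wt a k 0 + 2) * rho a k 0 * gammaProd a (wt a k 0) j := by
  induction j with
  | zero => simp [gammaProd]
  | succ j ih =>
    have hw := wt_pos ha hk j
    have hw0 := wt_pos ha hk 0
    have hwj : wt a k j = wt a k 0 + j := by simp [wt]; ring
    rw [gammaProd_succ, ← mul_assoc, ← ih, rho, wt_succ, hwj]
    field_simp
    ring

theorem edgeDensity_comm (a : ℝ) (k : ℕ) : ∀ i j, edgeDensity a k i j = edgeDensity a k j i
  | 0, 0 => rfl
  | 0, j + 1 => by
    rw [edgeDensity, edgeDensity, edgeDensity_comm a k 0 j, add_comm (wt a k 0)]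
  | i + 1, 0 => by
    rw [edgeDensity, edgeDensity, edgeDensity_comm a k i 0, add_comm (wt a k 0)]
  | i + 1, j + 1 => by
    rw [edgeDensity, edgeDensity, edgeDensity_comm a k i (j + 1), edgeDensity_comm a k (i + 1) j,
      add_comm (wt a k (i + 1)), add_comm (wt a k i * _)]
termination_by i j => i + j

/-- An exact solution of the recursion for `edgeDensity` at indices `i, j ≥ 1`. -/
noncomputable def edgeProfile (a : ℝ) (k i j : ℕ) : ℝ :=
  gammaProd a (2 * wt a k 0) (i + j) /
    (wt a k i * (wt a k i + 1) * (wt a k j * (wt a k j + 1)))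

theorem edgeProfile_comm (a : ℝ) (k i j : ℕ) : edgeProfile a k i j = edgeProfile a k j i := by
  unfold edgeProfile
  rw [add_comm i, mul_comm (wt a k i * _)]

theorem edgeProfile_succ_succ (ha : 0 < a) (hk : 1 ≤ k) (i j : ℕ) :
    edgeProfile a k (i + 1) (j + 1) * (wt a k (i + 1) + wt a k (j + 1) + a + 1) =
      wt a k i * edgeProfile a k i (j + 1) + wt a k j * edgeProfile a k (i + 1) j := by
  have hi := wt_pos ha hk i
  have hj := wt_pos ha hk j
  have hw0 := wt_pos ha hk 0
  have hwi : wt a k i = wt a k 0 + i := by simp [wt]; ring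
  have hwj : wt a k j = wt a k 0 + j := by simp [wt]; ring
  have h1 : i + 1 + (j + 1) = i + j + 1 + 1 := by ring
  have h2 : i + (j + 1) = i + j + 1 := by ring
  have h3 : i + 1 + j = i + j + 1 := by ring
  unfold edgeProfile
  rw [h1, h2, h3, gammaProd_succ _ _ (i + j + 1), wt_succ, wt_succ, hwi, hwj]
  push_cast
  field_simp
  ring

theorem edgeProfile_zero_succ (ha : 0 < a) (hk : 1 ≤ k) (j : ℕ) :
    edgeProfile a k 0 (j + 1) * (wt a k 0 + wt a k (j + 1) + a + 1) =
      wt a k j * edgeProfile a k 0 j + gammaProd a (2 * wt a k 0) j /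
        (wt a k 0 * ((wt a k j + 1) * (wt a k j + 2))) := by
  have hj := wt_pos ha hk j
  have hw0 := wt_pos ha hk 0
  have hwj : wt a k j = wt a k 0 + j := by simp [wt]; ring
  unfold edgeProfile
  rw [zero_add, zero_add, gammaProd_succ, wt_succ, hwj]
  field_simp
  ring

/-- Apart from nodes of degree `k` only, which are never adjacent, the edge density is at least of
the order of `edgeProfile`. -/
theorem exists_edgeProfile_le (ha : 0 < a) (hk : 1 ≤ k) :
    ∃ ε, 0 < ε ∧ ∀ i j, 0 < i + j → ε * edgeProfile a k i j ≤ edgeDensity a k i j := by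
  have hw0 := wt_pos ha hk 0
  have hρ0 := rho_pos ha hk 0
  obtain ⟨K, hK, hle⟩ := exists_gammaProd_le ha (x := 2 * wt a k 0) (y := wt a k 0)
    (by positivity) hw0
  set κ := wt a k 0 * (wt a k 0 + 1) * (wt a k 0 + 2) * rho a k 0 with hκ
  have hκ0 : 0 < κ := by positivity
  have hθ : ∀ j, gammaProd a (2 * wt a k 0) j ≤
      K / κ * (wt a k j * (wt a k j + 1) * (wt a k j + 2) * rho a k j) := by
    intro j
    rw [rho_eq_gammaProd ha hk, ← hκ]
    refine (hle j).trans (le_of_eq ?_)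
    field_simp
  -- The constant `ε` is dictated by the index `(0, 1)`, where the recursion starts.
  set ε := wt a k 0 * (wt a k 0 + 1) / (2 * wt a k 0 + 3) * (κ / K) with hε
  have hε0 : 0 < ε := by positivity
  have hεθ : ∀ j, ε * (gammaProd a (2 * wt a k 0) j /
      (wt a k 0 * ((wt a k j + 1) * (wt a k j + 2)))) * ((2 * wt a k 0 + 3) / (wt a k 0 + 1)) ≤
      wt a k j * rho a k j := by
    intro j
    have hw := wt_pos ha hk j
    have h1 : ε * (gammaProd a (2 * wt a k 0) j /
        (wt a k 0 * ((wt a k j + 1) * (wt a k j + 2)))) * ((2 * wt a k 0 + 3) / (wt a k 0 + 1)) =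
        κ / K * gammaProd a (2 * wt a k 0) j / ((wt a k j + 1) * (wt a k j + 2)) := by
      rw [hε]; field_simp
    rw [h1, div_le_iff₀ (by positivity)]
    have h2 := mul_le_mul_of_nonneg_left (hθ j) (by positivity : 0 ≤ κ / K)
    refine h2.trans (le_of_eq ?_)
    field_simp
  have hbd : ∀ j, ε * edgeProfile a k 0 (j + 1) ≤ edgeDensity a k 0 (j + 1) := by
    intro j
    induction j with
    | zero =>
      have h1 := wt_pos ha hk (0 + 1)
      rw [edgeDensity, edgeDensity, mul_zero, zero_add (wt a k 0 * rho a k 0),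
        le_div_iff₀ (by positivity), mul_assoc, edgeProfile_zero_succ ha hk]
      refine le_trans (le_of_eq ?_) (hεθ 0)
      unfold edgeProfile
      rw [add_zero]
      field_simp
      ring
    | succ j ih =>
      have h1 := wt_pos ha hk (j + 1)
      have h2 := wt_pos ha hk (j + 2)
      rw [edgeDensity, le_div_iff₀ (by positivity), mul_assoc, edgeProfile_zero_succ ha hk, mul_add]
      refine add_le_add ?_ (le_trans ?_ (hεθ (j + 1)))
      · rw [mul_left_comm]
        exact mul_le_mul_of_nonneg_left ih h1.le
      · refine le_mul_of_one_le_right ?_ ((one_le_div (by positivity)).2 (by linarith))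
        have := gammaProd_pos ha (x := 2 * wt a k 0) (by positivity) (j + 1)
        positivity
  refine ⟨ε, hε0, ?_⟩
  suffices H : ∀ m i j, i + j = m + 1 → ε * edgeProfile a k i j ≤ edgeDensity a k i j from
    fun i j h => H (i + j - 1) i j (by omega)
  intro m
  induction m with
  | zero =>
    intro i j hij
    rcases Nat.eq_zero_or_pos i with rfl | hi
    · obtain rfl : j = 1 := by omega
      exact hbd 0
    · obtain rfl : i = 1 := by omega
      obtain rfl : j = 0 := by omega
      rw [edgeProfile_comm, edgeDensity_comm]
      exact hbd 0
  | succ m ih =>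
    intro i j hij
    match i, j with
    | 0, 0 => omega
    | 0, j + 1 => exact hbd j
    | i + 1, 0 =>
      rw [edgeProfile_comm, edgeDensity_comm]
      exact hbd i
    | i + 1, j + 1 =>
      have hi := wt_pos ha hk i
      have hj := wt_pos ha hk j
      have hi' := wt_pos ha hk (i + 1)
      have hj' := wt_pos ha hk (j + 1)
      rw [edgeDensity, le_div_iff₀ (by positivity), mul_assoc, edgeProfile_succ_succ ha hk, mul_add]
      have h1 := mul_le_mul_of_nonneg_left (ih i (j + 1) (by omega)) hi.le
      have h2 := mul_le_mul_of_nonneg_left (ih (i + 1) j (by omega)) hj.le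
      linarith

theorem exists_rpow_le_edgeDensity (ha : 0 < a) (hk : 1 ≤ k) :
    ∃ c, 0 < c ∧ ∀ i j, 0 < i + j → c * (((k + i : ℕ) : ℝ) + (k + j : ℕ)) ^ (1 - a) ≤
      edgeDensity a k i j * (((k + i : ℕ) : ℝ) ^ 2 * ((k + j : ℕ) : ℝ) ^ 2) := by
  have hk' : (1 : ℝ) ≤ k := by exact_mod_cast hk
  have hw0 := wt_pos ha hk 0
  obtain ⟨ε, hε, hle⟩ := exists_edgeProfile_le ha hk
  obtain ⟨K, hK, hg⟩ := exists_rpow_le_gammaProd ha (x := 2 * wt a k 0) (b := 2 * k)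
    (by positivity) (by positivity)
  have hwt : ∀ i, wt a k i * (wt a k i + 1) ≤ (1 + a) * (2 + a) * ((k + i : ℕ) : ℝ) ^ 2 := by
    intro i
    have hw := wt_pos ha hk i
    have hi : (0 : ℝ) ≤ i := i.cast_nonneg
    have h1 : wt a k i ≤ (1 + a) * ((k + i : ℕ) : ℝ) := by
      unfold wt; push_cast; nlinarith
    have h2 : wt a k i + 1 ≤ (2 + a) * ((k + i : ℕ) : ℝ) := by
      unfold wt; push_cast; nlinarith
    calc wt a k i * (wt a k i + 1) ≤ ((1 + a) * ((k + i : ℕ) : ℝ)) * ((2 + a) * ((k + i : ℕ) : ℝ)) :=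
          mul_le_mul h1 h2 (by positivity) (by positivity)
      _ = _ := by ring
  refine ⟨ε / K / ((1 + a) * (2 + a)) ^ 2, by positivity, fun i j hij => ?_⟩
  have hi := wt_pos ha hk i
  have hj := wt_pos ha hk j
  have h1 := hle i j hij
  have h2 := hg (i + j)
  have e1 : ((i + j : ℕ) : ℝ) + 2 * k = ((k + i : ℕ) : ℝ) + (k + j : ℕ) := by push_cast; ring
  rw [e1] at h2
  set g := gammaProd a (2 * wt a k 0) (i + j) with hgdef
  have he0 := edgeDensity_nonneg ha hk i j
  have h3 : ε * g ≤ edgeDensity a k i j *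
      (wt a k i * (wt a k i + 1) * (wt a k j * (wt a k j + 1))) := by
    rw [edgeProfile, ← mul_div_assoc, div_le_iff₀ (by positivity)] at h1
    exact h1
  have h4 : wt a k i * (wt a k i + 1) * (wt a k j * (wt a k j + 1)) ≤
      ((1 + a) * (2 + a)) ^ 2 * (((k + i : ℕ) : ℝ) ^ 2 * ((k + j : ℕ) : ℝ) ^ 2) :=
    (mul_le_mul (hwt i) (hwt j) (by positivity) (by positivity)).trans (le_of_eq (by ring))
  have h5 := mul_le_mul_of_nonneg_left h4 he0
  have h6 : ε / K * (((k + i : ℕ) : ℝ) + (k + j : ℕ)) ^ (1 - a) ≤ ε * g := by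
    have := mul_le_mul_of_nonneg_left h2 (by positivity : 0 ≤ ε / K)
    refine this.trans (le_of_eq ?_)
    field_simp
  rw [div_mul_eq_mul_div, div_le_iff₀ (by positivity)]
  linarith

/-! ### Concentration -/

theorem meanM_X_eq (k t i j : ℕ) :
    meanM a k (k * t) (fun M => (M.X (k + i) (k + j) t : ℝ)) =
      meanM a k (k * t) (numEdges k t i j) := by
  congr 1
  ext M
  exact X_eq_numEdges k t i j M

open Classical in
/-- Chebyshev's inequality with the variance bound and the lower bound for the density. At degrees
`(k, k)` the density is zero, and so is `X`. -/
theorem exists_meanM_deviation_le (ha : 0 < a) (hk : 1 ≤ k) :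
    ∃ K, ∀ i j t : ℕ, 1 ≤ t → ∀ ε : ℝ, 0 < ε →
      meanM a k (k * t) (fun M => if |(M.X (k + i) (k + j) t : ℝ) - k * edgeDensity a k i j * t| ≤
        ε * (k * edgeDensity a k i j * t) then 0 else 1) ≤
      K / ε ^ 2 * ((((k + i : ℕ) : ℝ) + (k + j : ℕ)) ^ a * ((k + i : ℕ) : ℝ) ^ 2 *
        ((k + j : ℕ) : ℝ) ^ 2 / √(t : ℝ)) ^ 2 := by
  have hk' : (1 : ℝ) ≤ k := by exact_mod_cast hk
  obtain ⟨B, hB⟩ := exists_abs_meanM_numEdges_sub_le ha hk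
  obtain ⟨c, hc, hlow⟩ := exists_rpow_le_edgeDensity ha hk
  refine ⟨(B ^ 2 + 4 * k) / c ^ 2, fun i j t ht ε hε => ?_⟩
  have ht' : (1 : ℝ) ≤ t := by exact_mod_cast ht
  rcases Nat.eq_zero_or_pos (i + j) with hij | hij
  · obtain rfl : i = 0 := by omega
    obtain rfl : j = 0 := by omega
    have hX := expEdges_zero_zero ha hk (k * t)
    rw [expEdges, Nat.mul_div_cancel_left _ (by omega), ← meanM_X_eq] at hX
    have hle : meanM a k (k * t) (fun M => if |(M.X (k + 0) (k + 0) t : ℝ) -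
        k * edgeDensity a k 0 0 * t| ≤ ε * (k * edgeDensity a k 0 0 * t) then 0 else 1) ≤ 0 := by
      refine le_trans (meanM_mono ha fun M => ?_) hX.le
      split_ifs with h
      · exact Nat.cast_nonneg _
      · rw [edgeDensity, mul_zero, zero_mul, sub_zero, mul_zero, abs_le] at h
        rcases Nat.eq_zero_or_pos (M.X (k + 0) (k + 0) t) with h0 | h0
        · rw [h0] at h; simp at h
        · exact_mod_cast h0
    exact hle.trans (by positivity)
  · set d₁ : ℝ := ((k + i : ℕ) : ℝ) with hd₁
    set d₂ : ℝ := ((k + j : ℕ) : ℝ) with hd₂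
    have hd₁' : 1 ≤ d₁ := by rw [hd₁]; exact_mod_cast (by omega : 1 ≤ k + i)
    have hd₂' : 1 ≤ d₂ := by rw [hd₂]; exact_mod_cast (by omega : 1 ≤ k + j)
    set e := edgeDensity a k i j with he
    set m : ℝ := k * e * t with hm
    have hs : 0 < √(t : ℝ) := Real.sqrt_pos.2 (by linarith)
    have hst : √(t : ℝ) ^ 2 = t := Real.sq_sqrt (by linarith)
    have hpow : 0 < (d₁ + d₂) ^ a := Real.rpow_pos_of_pos (by linarith) _
    set q : ℝ := (d₁ + d₂) ^ a * d₁ ^ 2 * d₂ ^ 2 / √(t : ℝ) with hq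
    have hq0 : 0 < q := by positivity
    have hmain : c * ((d₁ + d₂) * √(t : ℝ)) ≤ m * q := by
      have h1 := hlow i j hij
      rw [Real.rpow_sub (by linarith), Real.rpow_one, ← mul_div_assoc, div_le_iff₀ hpow] at h1
      have he0 := edgeDensity_nonneg ha hk i j
      have h2 : m * q = k * (e * (d₁ ^ 2 * d₂ ^ 2) * (d₁ + d₂) ^ a) * √(t : ℝ) := by
        rw [hm, hq]
        nth_rewrite 1 [← hst]
        field_simp
      rw [h2, ← mul_assoc]
      refine mul_le_mul_of_nonneg_right (h1.trans (le_mul_of_one_le_left ?_ hk')) hs.le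
      positivity
    have hm0 : 0 < m := by
      by_contra! hcon
      have h1 : m * q ≤ 0 := mul_nonpos_of_nonpos_of_nonneg hcon hq0.le
      have h2 : 0 < c * ((d₁ + d₂) * √(t : ℝ)) := by positivity
      linarith
    have hvar : meanM a k (k * t) (fun M => ((M.X (k + i) (k + j) t : ℝ) - m) ^ 2) ≤
        (B ^ 2 + 4 * k) * ((d₁ + d₂) ^ 2 * t) := by
      have h1 := meanM_X_sq_le ha k (k * t) (k + i) (k + j) t
      have h2 := hB t i j
      rw [← meanM_X_eq] at h2
      set E := meanM a k (k * t) (fun M => (M.X (k + i) (k + j) t : ℝ))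
      have h3 : meanM a k (k * t) (fun M => ((M.X (k + i) (k + j) t : ℝ) - m) ^ 2) =
          meanM a k (k * t) (fun M => (M.X (k + i) (k + j) t : ℝ) ^ 2) + (-(2 * m) * E + m ^ 2) := by
        rw [← meanM_const_mul, ← meanM_const (k := k) (n := k * t) ha (m ^ 2),
          ← meanM_add, ← meanM_add]
        congr 1
        ext M
        ring
      have h4 : (E - m) ^ 2 ≤ B ^ 2 := sq_le_sq' (abs_le.1 h2).1 (abs_le.1 h2).2
      have h5 : 1 ≤ (d₁ + d₂) ^ 2 * t := by nlinarith
      rw [h3]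
      push_cast at h1
      have hd : ((k : ℝ) + i + (k + j)) = d₁ + d₂ := by rw [hd₁, hd₂]; push_cast; ring
      rw [hd] at h1
      nlinarith [sq_nonneg B]
    have hcheb : meanM a k (k * t) (fun M => if |(M.X (k + i) (k + j) t : ℝ) - m| ≤ ε * m then 0
        else 1) ≤ 1 / (ε * m) ^ 2 *
          meanM a k (k * t) (fun M => ((M.X (k + i) (k + j) t : ℝ) - m) ^ 2) := by
      rw [← meanM_const_mul]
      refine meanM_mono ha fun M => ?_
      split_ifs with h
      · positivity
      · push Not at h
        rw [one_div, inv_mul_eq_div, one_le_div (by positivity), ← sq_abs (_ - m)]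
        exact pow_le_pow_left₀ (by positivity) h.le 2
    refine hcheb.trans ((mul_le_mul_of_nonneg_left hvar (by positivity)).trans ?_)
    have h6 : (c * ((d₁ + d₂) * √(t : ℝ))) ^ 2 ≤ (m * q) ^ 2 :=
      pow_le_pow_left₀ (by positivity) hmain 2
    have h7 : (d₁ + d₂) ^ 2 * t ≤ (m * q) ^ 2 / c ^ 2 := by
      rw [le_div_iff₀ (by positivity)]
      calc (d₁ + d₂) ^ 2 * t * c ^ 2 = (c * ((d₁ + d₂) * √(t : ℝ))) ^ 2 := by
            rw [mul_pow, mul_pow, hst]; ring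
        _ ≤ _ := h6
    calc 1 / (ε * m) ^ 2 * ((B ^ 2 + 4 * k) * ((d₁ + d₂) ^ 2 * t))
        ≤ 1 / (ε * m) ^ 2 * ((B ^ 2 + 4 * k) * ((m * q) ^ 2 / c ^ 2)) := by gcongr
      _ = (B ^ 2 + 4 * k) / c ^ 2 / ε ^ 2 * q ^ 2 := by field_simp

end BuckleyOsthus

open BuckleyOsthus in
/-- `X(d₁, d₂, t) ∼ c_X(d₁, d₂) t` with probability tending to one, where `c_X` is the function
(unique on `d₁, d₂ ≥ k`) with `E X(d₁, d₂, t) = c_X(d₁, d₂) t + O(1)`. -/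
theorem corollary2 (k : ℕ) (hk : 1 ≤ k) (a : ℝ) (ha : 0 < a) :
    ∃ cX : ℕ → ℕ → ℝ,
      (∃ C : ℝ, ∀ d₁ d₂ t : ℕ, k ≤ d₁ → k ≤ d₂ → 1 ≤ t →
        |expX ha k d₁ d₂ t - cX d₁ d₂ * t| ≤ C) ∧
      ∀ d₁ d₂ : ℕ → ℕ, (∀ᶠ t in atTop, k ≤ d₁ t ∧ k ≤ d₂ t) →
        ((fun t : ℕ => ((d₁ t : ℝ) + d₂ t) ^ a * (d₁ t : ℝ) ^ 2 * (d₂ t : ℝ) ^ 2)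
          =o[atTop] fun t : ℕ => √(t : ℝ)) →
        ∀ ε : ℝ, 0 < ε →
          Tendsto (fun t : ℕ => (H ha k t).toMeasure
              {G | |(Multigraph.X (d₁ t) (d₂ t) t G : ℝ) - cX (d₁ t) (d₂ t) * t|
                ≤ ε * (cX (d₁ t) (d₂ t) * t)})
            atTop (𝓝 1) := by
  classical
  refine ⟨fun d₁ d₂ => k * edgeDensity a k (d₁ - k) (d₂ - k), ?_, ?_⟩
  · obtain ⟨B, hB⟩ := exists_abs_meanM_numEdges_sub_le ha hk
    refine ⟨B, fun d₁ d₂ t h₁ h₂ _ => ?_⟩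
    obtain ⟨i, rfl⟩ := Nat.exists_eq_add_of_le h₁
    obtain ⟨j, rfl⟩ := Nat.exists_eq_add_of_le h₂
    rw [expX, integral_H ha k t fun G => (Multigraph.X (k + i) (k + j) t G : ℝ), meanM_X_eq]
    simp only [Nat.add_sub_cancel_left]
    exact hB t i j
  · intro d₁ d₂ hd ho ε hε
    obtain ⟨K, hK⟩ := exists_meanM_deviation_le ha hk
    have hq := ho.tendsto_div_nhds_zero
    have hq2 := (hq.pow 2).const_mul (K / ε ^ 2)
    rw [zero_pow two_ne_zero, mul_zero] at hq2
    have hlow := ENNReal.tendsto_ofReal (hq2.const_sub 1)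
    rw [sub_zero, ENNReal.ofReal_one] at hlow
    refine tendsto_of_tendsto_of_tendsto_of_le_of_le' hlow tendsto_const_nhds ?_
      (Eventually.of_forall fun t => prob_le_one)
    filter_upwards [hd, eventually_ge_atTop 1] with t ht ht1
    obtain ⟨i, hi⟩ := Nat.exists_eq_add_of_le ht.1
    obtain ⟨j, hj⟩ := Nat.exists_eq_add_of_le ht.2
    have h := hK i j t ht1 ε hε
    rw [← hi, ← hj] at h
    rw [measure_H ha k t]
    refine ENNReal.ofReal_le_ofReal ?_
    simp only [show d₁ t - k = i by omega, show d₂ t - k = j by omega]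
    have hcompl : ∀ p : Multigraph → Prop, meanM a k (k * t) (fun G => if p G then 1 else 0) =
        1 - meanM a k (k * t) (fun G => if p G then 0 else 1) := by
      intro p
      rw [eq_sub_iff_add_eq, ← meanM_add]
      refine Eq.trans (congrArg _ (funext fun G => ?_)) (meanM_const ha 1)
      split_ifs <;> norm_num
    rw [hcompl]
    linarith
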